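/- Consider the following repeated zero-sum game with parameter $p\in[\tfrac12,1]$. The system is in one of two states $\underline s,\bar s$. The initial state is $\underline s$ with probability $\theta_0\in[0,1]$ (known to both players); after each stage the state is kept with probability $p$ and switched with probability $1-p$. At each stage Player 1, who knows the current and all past states and all past moves, plays $T$ or $B$, and simultaneously Player 2, who knows only the past moves of both players, plays $L$ or $R$. Player 1 gains $1$ if the state is $\underline s$ and $(T,L)$ is played, or if the state is $\bar s$ and $(B,R)$ is played; otherwise he gains $0$. A (mixed) strategy of a player assigns to each possible information of that player a probability distribution on his two moves. For strategies $\sigma,\tau$ of Players 1 and 2 let $\gamma_n(\sigma,\tau)$ be the expected average gain of Player 1 over the first $n$ stages. A strategy $\sigma$ guarantees $v$ if $\liminf_n\gamma_n(\sigma,\tau)\ge v$ for all $\tau$; a strategy $\tau$ guarantees $v$ if $\limsup_n\gamma_n(\sigma,\tau)\le v$ for all $\sigma$. The number $v$ is the value of the game if each player has a strategy that guarantees $v$, and a strategy of Player 1 is optimal if it guarantees the value. The strategy $\sigma^*$ of Hörner, Rosenberg, Solan and Vieille is the following. Player 1 maintains a number $\theta\in[0,1]$, initially $\theta=\theta_0$.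 If $\theta\le\frac12$, he plays $T$ with probability $1$ in state $\underline s$ and with probability $\frac{1-2\theta}{1-\theta}$ in state $\bar s$; if $\theta\ge\frac12$, he plays $T$ with probability $\frac{1-\theta}{\theta}$ in state $\underline s$ and with probability $0$ in state $\bar s$. After he has played $T$ or $B$, $\theta$ is replaced by $f_T(\theta)$ or $f_B(\theta)$ respectively, where $$f_T(\theta)=\begin{cases}p&\theta\ge\frac12\\ p\frac{\theta}{1-\theta}+(1-p)\frac{1-2\theta}{1-\theta}&\theta\le\frac12\end{cases}\qquad f_B(\theta)=\begin{cases}p\frac{2\theta-1}{\theta}+(1-p)\frac{1-\theta}{\theta}&\theta\ge\frac12\\ 1-p&\theta\le\frac12.\end{cases}$$ Then: 1. For every $p$ with $\frac12\le p<0.719$ and every $\theta_0\in[0,1]$, the game has a value and $\sigma^*$ is optimal for Player 1. 2. For $p=0.73275300915<0.733$ and every $\theta_0\in[0,1]$, $\sigma^*$ is not optimal; indeed, some strategy $\sigma$ of Player 1 guarantees a number $v$ that $\sigma^*$ does not guarantee. 3. Let $p_c$ be the supremum of all $q\in[\frac12,1]$ such that $\sigma^*$ is optimal for all $p\in[\frac12,q]$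 and all $\theta_0\in[0,1]$. Then $0.719<p_c<0.733$. -/

import Mathlib

open Filter

namespace RenaultGame

/-- The state of the system: `low` is `s̲` and `high` is `s̄`. -/
inductive State
  | low
  | high
  deriving DecidableEq

instance : Fintype State where
  elems := {State.low, State.high}
  complete := by intro x; cases x <;> simp

/-- Moves of Player 1: top, bottom. -/
inductive Move1
  | T
  | B
  deriving DecidableEq

instance : Fintype Move1 where
  elems := {Move1.T, Move1.B}
  complete := by intro x; cases x <;> simp

/-- Moves of Player 2: left, right. -/
inductive Move2
  | L
  | R
  deriving DecidableEq

instance : Fintype Move2 where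
  elems := {Move2.L, Move2.R}
  complete := by intro x; cases x <;> simp

/-- Everything that happens in one stage: the state and the two moves. -/
abbrev Stage := State × Move1 × Move2

/-- The gain of Player 1 in one stage: the matrix is `(1 0; 0 0)` in state `low` and
`(0 0; 0 1)` in state `high`. -/
def gain : Stage → ℝ
  | (State.low, Move1.T, Move2.L) => 1
  | (State.high, Move1.B, Move2.R) => 1
  | _ => 0

/-- A (behavioural, mixed) strategy of Player 1: the probability of playing `T`, given the past
(all past states and moves, most recent stage first) and the current state. -/
abbrev Strategy1 := List Stage → State → unitInterval

/-- A (behavioural, mixed) strategy of Player 2: the probability of playing `L`, given the past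
moves of both players, most recent first. Player 2 sees neither the states nor the gains. -/
abbrev Strategy2 := List (Move1 × Move2) → unitInterval

/-- Probability of a move of Player 1 who plays `T` with probability `q`. -/
def moveProb1 (q : ℝ) : Move1 → ℝ
  | Move1.T => q
  | Move1.B => 1 - q

/-- Probability of a move of Player 2 who plays `L` with probability `q`. -/
def moveProb2 (q : ℝ) : Move2 → ℝ
  | Move2.L => q
  | Move2.R => 1 - q

/-- Conditional probability that the current state is `s` given the past: the first state is `low`
with probability `θ₀`; afterwards the state is kept with probability `p` and switched with
probability `1 - p`. -/
def stateProb (p θ₀ : ℝ) : List Stage → State → ℝ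
  | [], State.low => θ₀
  | [], State.high => 1 - θ₀
  | (s', _, _) :: _, s => if s = s' then p else 1 - p

/-- Probability that the first stages of the play are exactly those in the list
(most recent stage first). -/
noncomputable def playProb (p θ₀ : ℝ) (σ : Strategy1) (τ : Strategy2) : List Stage → ℝ
  | [] => 1
  | (s, a, b) :: h =>
      playProb p θ₀ σ τ h * stateProb p θ₀ h s * moveProb1 (σ h s) a *
        moveProb2 (τ (h.map Prod.snd)) b

/-- Expected average gain of Player 1 over the first `n` stages. -/
noncomputable def avgGain (p θ₀ : ℝ) (σ : Strategy1) (τ : Strategy2) (n : ℕ) : ℝ :=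
  (∑ h : List.Vector Stage n, playProb p θ₀ σ τ h.toList * (h.toList.map gain).sum) / n

/-- Against every strategy of Player 2, the long-term expected gain of Player 1 under `σ` is at
least `v`. -/
def Guarantees1 (p θ₀ : ℝ) (σ : Strategy1) (v : ℝ) : Prop :=
  ∀ τ : Strategy2, v ≤ liminf (avgGain p θ₀ σ τ) atTop

/-- Against every strategy of Player 1, the long-term expected gain of Player 1 is at most `v` if
Player 2 uses `τ`. -/
def Guarantees2 (p θ₀ : ℝ) (τ : Strategy2) (v : ℝ) : Prop :=
  ∀ σ : Strategy1, limsup (avgGain p θ₀ σ τ) atTop ≤ v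

/-- `v` is the value of the game: Player 1 has a strategy that guarantees at least `v`, and
Player 2 has a strategy that guarantees at most `v`. -/
def IsValue (p θ₀ v : ℝ) : Prop :=
  (∃ σ, Guarantees1 p θ₀ σ v) ∧ ∃ τ, Guarantees2 p θ₀ τ v

/-- `σ` is optimal for Player 1: it guarantees the value of the game. -/
def IsOptimal (p θ₀ : ℝ) (σ : Strategy1) : Prop :=
  ∃ v, IsValue p θ₀ v ∧ Guarantees1 p θ₀ σ v

/-- The update maps `f_T` and `f_B` of the internal state `θ` of Player 1. -/
noncomputable def updateReal (p θ : ℝ) : Move1 → ℝ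
  | Move1.T =>
      if 1 / 2 ≤ θ then p else p * (θ / (1 - θ)) + (1 - p) * ((1 - 2 * θ) / (1 - θ))
  | Move1.B =>
      if 1 / 2 ≤ θ then p * ((2 * θ - 1) / θ) + (1 - p) * ((1 - θ) / θ) else 1 - p

/-- The probability with which `σ*` plays `T`, as a function of `θ` and the state. -/
noncomputable def playTReal (θ : ℝ) : State → ℝ
  | State.low => if θ ≤ 1 / 2 then 1 else (1 - θ) / θ
  | State.high => if θ ≤ 1 / 2 then (1 - 2 * θ) / (1 - θ) else 0

theorem updateReal_mem (p θ : unitInterval) (a : Move1) :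
    updateReal p θ a ∈ unitInterval := by
  obtain ⟨p, hp0, hp1⟩ := p
  obtain ⟨θ, h0, h1⟩ := θ
  cases a <;> simp only [updateReal] <;> split_ifs with h
  · exact ⟨hp0, hp1⟩
  · push Not at h
    have hd : 0 < 1 - θ := by linarith
    have e : p * (θ / (1 - θ)) + (1 - p) * ((1 - 2 * θ) / (1 - θ))
        = (p * θ + (1 - p) * (1 - 2 * θ)) / (1 - θ) := by ring
    rw [e]
    refine ⟨div_nonneg ?_ hd.le, (div_le_one hd).2 ?_⟩ <;> nlinarith
  · have hd : 0 < θ := by linarith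
    have e : p * ((2 * θ - 1) / θ) + (1 - p) * ((1 - θ) / θ)
        = (p * (2 * θ - 1) + (1 - p) * (1 - θ)) / θ := by ring
    rw [e]
    refine ⟨div_nonneg ?_ hd.le, (div_le_one hd).2 ?_⟩ <;> nlinarith
  · exact ⟨by linarith, by linarith⟩

theorem playTReal_mem (θ : unitInterval) (s : State) : playTReal θ s ∈ unitInterval := by
  obtain ⟨θ, h0, h1⟩ := θ
  cases s <;> simp only [playTReal] <;> split_ifs with h
  · exact ⟨zero_le_one, le_rfl⟩
  · push Not at h
    have hd : 0 < θ := by linarith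
    exact ⟨div_nonneg (by linarith) hd.le, (div_le_one hd).2 (by linarith)⟩
  · have hd : 0 < 1 - θ := by linarith
    exact ⟨div_nonneg (by linarith) hd.le, (div_le_one hd).2 (by linarith)⟩
  · exact ⟨le_rfl, zero_le_one⟩

/-- The internal state `θ` of Player 1 after the given past. It starts at the initial probability
`θ₀` of state `low`, which is the initial belief of Player 2, and is then updated by `f_T` and
`f_B` according to the moves of Player 1. -/
noncomputable def belief (p θ₀ : unitInterval) : List Stage → unitInterval
  | [] => θ₀
  | (_, a, _) :: h => ⟨updateReal p (belief p θ₀ h) a, updateReal_mem p (belief p θ₀ h) a⟩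

/-- The strategy `σ*` of Player 1. -/
noncomputable def sigmaStar (p θ₀ : unitInterval) : Strategy1 :=
  fun h s => ⟨playTReal (belief p θ₀ h) s, playTReal_mem (belief p θ₀ h) s⟩

/-- `σ*` is optimal for the parameter `p`, for every initial distribution of the state. -/
def SigmaStarOptimal (p : unitInterval) : Prop :=
  ∀ θ₀ : unitInterval, IsOptimal p θ₀ (sigmaStar p θ₀)

/-- The critical parameter: the supremum of the `q ∈ [1/2, 1]` such that `σ*` is optimal for all
`p ∈ [1/2, q]`. -/
noncomputable def criticalParameter : ℝ :=
  sSup {q : ℝ | 1 / 2 ≤ q ∧ q ≤ 1 ∧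
    ∀ p : unitInterval, 1 / 2 ≤ (p : ℝ) → (p : ℝ) ≤ q → SigmaStarOptimal p}

end RenaultGame

/-!
An equalizing strategy of Player 1 makes the expected stage gain independent of the moves of
Player 2. It guarantees `v` as soon as the stage gain plus the expected increase of some bounded
potential of the belief is at least `v`. For `σ*` the potential is affine in the expected time `ℓ`
until the state is revealed, as a function of the folded belief `min θ (1 - θ)`, and the best
guarantee is `1 / ℓ (1 - p)`: one unit is gained per revelation, and a revelation leads back to the
folded belief `1 - p`.

For `p ≤ 0.7191` the function `ℓ` is convex and decreasing, but not too fast, so Player 2 can use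
its tangents along the orbit of `1 - p` as potentials and hold Player 1 down to `1 / ℓ (1 - p)`.

At the bad parameter `ℓ` falls so steeply to the right of `1 - p` and of the 58th point of the orbit
that Player 1 profits from revealing slightly less at the 57th point, which lies in `(1/3, 1/2)`.
Adding to the potential a small bonus that grows threefold with every step towards this point
spreads the profit over all beliefs.
-/

namespace RenaultGame

/-! ### Expected gain and potentials -/

theorem sum_state (f : State → ℝ) : ∑ s, f s = f State.low + f State.high :=
  Finset.sum_pair (by decide)

theorem sum_move1 (f : Move1 → ℝ) : ∑ a, f a = f Move1.T + f Move1.B :=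
  Finset.sum_pair (by decide)

theorem sum_move2 (f : Move2 → ℝ) : ∑ b, f b = f Move2.L + f Move2.R :=
  Finset.sum_pair (by decide)

theorem moveProb1_nonneg (q : unitInterval) (a : Move1) : 0 ≤ moveProb1 q a := by
  cases a
  exacts [q.2.1, sub_nonneg.2 q.2.2]

theorem moveProb2_nonneg (q : unitInterval) (b : Move2) : 0 ≤ moveProb2 q b := by
  cases b
  exacts [q.2.1, sub_nonneg.2 q.2.2]

theorem sum_moveProb1 (q : ℝ) : ∑ a, moveProb1 q a = 1 := by
  rw [sum_move1]
  exact add_sub_cancel q 1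

theorem sum_moveProb2 (q : ℝ) : ∑ b, moveProb2 q b = 1 := by
  rw [sum_move2]
  exact add_sub_cancel q 1

theorem stateProb_nonneg (p θ₀ : unitInterval) (h : List Stage) (s : State) :
    0 ≤ stateProb p θ₀ h s := by
  rcases h with _ | ⟨⟨s', a, b⟩, h⟩
  · cases s
    exacts [θ₀.2.1, sub_nonneg.2 θ₀.2.2]
  · simp only [stateProb]
    split_ifs
    exacts [p.2.1, sub_nonneg.2 p.2.2]

theorem stateProb_high (p θ₀ : ℝ) (h : List Stage) :
    stateProb p θ₀ h State.high = 1 - stateProb p θ₀ h State.low := by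
  rcases h with _ | ⟨⟨s', a, b⟩, h⟩
  · rfl
  · cases s' <;> simp [stateProb]

theorem sum_stateProb (p θ₀ : ℝ) (h : List Stage) : ∑ s, stateProb p θ₀ h s = 1 := by
  rw [sum_state, stateProb_high, add_sub_cancel]

/-- Probability of moving from the state `s` to the state `s'`. -/
def transProb (p : ℝ) (s s' : State) : ℝ := if s' = s then p else 1 - p

theorem stateProb_cons (p θ₀ : ℝ) (x : Stage) (h : List Stage) (s : State) :
    stateProb p θ₀ (x :: h) s = transProb p x.1 s := rfl

/-- The part of a history that Player 2 observes. -/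
abbrev publicPast (h : List Stage) : List (Move1 × Move2) := h.map Prod.snd

/-- Conditional probability that the next stage is the given one, after the history `h`. -/
noncomputable def nextProb (p θ₀ : ℝ) (σ : Strategy1) (τ : Strategy2) (h : List Stage) :
    Stage → ℝ
  | (s, a, b) =>
      stateProb p θ₀ h s * moveProb1 (σ h s) a * moveProb2 (τ (publicPast h)) b

/-- Conditional expectation of a function of the next stage, after the history `h`. -/
noncomputable def nextExpect (p θ₀ : ℝ) (σ : Strategy1) (τ : Strategy2) (h : List Stage)
    (f : Stage → ℝ) : ℝ :=
  ∑ x, nextProb p θ₀ σ τ h x * f x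

/-- Expectation of a function of the first `n` stages of the play. -/
noncomputable def expect (p θ₀ : ℝ) (σ : Strategy1) (τ : Strategy2) (n : ℕ)
    (φ : List Stage → ℝ) : ℝ :=
  ∑ h : List.Vector Stage n, playProb p θ₀ σ τ h.toList * φ h.toList

/-- Expected total gain of Player 1 over the first `n` stages. -/
noncomputable def totalGain (p θ₀ : ℝ) (σ : Strategy1) (τ : Strategy2) (n : ℕ) : ℝ :=
  expect p θ₀ σ τ n fun h => (h.map gain).sum

/-- Conditional expectation, after the history `h`, of the next gain plus the increase of the
potential `Φ`. -/
noncomputable def drift (p θ₀ : ℝ) (σ : Strategy1) (τ : Strategy2) (Φ : List Stage → ℝ)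
    (h : List Stage) : ℝ :=
  nextExpect p θ₀ σ τ h (fun x => gain x + Φ (x :: h)) - Φ h

theorem avgGain_eq_totalGain_div (p θ₀ : ℝ) (σ : Strategy1) (τ : Strategy2) (n : ℕ) :
    avgGain p θ₀ σ τ n = totalGain p θ₀ σ τ n / n := rfl

section Expectation

variable (p θ₀ : ℝ) (σ : Strategy1) (τ : Strategy2)

theorem sum_nextProb (h : List Stage) : ∑ x, nextProb p θ₀ σ τ h x = 1 := by
  simp only [Fintype.sum_prod_type, nextProb, ← Finset.mul_sum, sum_moveProb1, sum_moveProb2,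
    mul_one, sum_stateProb]

theorem nextExpect_eq_sum_state (h : List Stage) (f : Stage → ℝ) :
    nextExpect p θ₀ σ τ h f = ∑ s, stateProb p θ₀ h s *
      ∑ a, ∑ b, moveProb1 (σ h s) a * moveProb2 (τ (publicPast h)) b * f (s, a, b) := by
  simp only [nextExpect, Fintype.sum_prod_type, nextProb, Finset.mul_sum, mul_assoc]

theorem nextExpect_add (h : List Stage) (f g : Stage → ℝ) :
    nextExpect p θ₀ σ τ h (fun x => f x + g x) =
      nextExpect p θ₀ σ τ h f + nextExpect p θ₀ σ τ h g := by
  simp only [nextExpect, mul_add, Finset.sum_add_distrib]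

theorem nextExpect_const (h : List Stage) (c : ℝ) :
    nextExpect p θ₀ σ τ h (fun _ => c) = c := by
  rw [nextExpect, ← Finset.sum_mul, sum_nextProb, one_mul]

theorem expect_zero (φ : List Stage → ℝ) : expect p θ₀ σ τ 0 φ = φ [] := by
  simp [expect, playProb]

theorem expect_succ (n : ℕ) (φ : List Stage → ℝ) :
    expect p θ₀ σ τ (n + 1) φ =
      expect p θ₀ σ τ n fun h => nextExpect p θ₀ σ τ h fun x => φ (x :: h) := by
  let consEquiv : Stage × List.Vector Stage n ≃ List.Vector Stage (n + 1) :=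
    ⟨fun x => x.1 ::ᵥ x.2, fun h => (h.head, h.tail), fun x => by simp, fun h => by simp⟩
  rw [expect, ← consEquiv.sum_comp, Fintype.sum_prod_type_right]
  refine Finset.sum_congr rfl fun h _ => ?_
  simp only [nextExpect, Finset.mul_sum]
  refine Finset.sum_congr rfl fun ⟨s, a, b⟩ _ => ?_
  simp only [consEquiv, Equiv.coe_fn_mk, List.Vector.toList_cons, playProb, nextProb]
  ring

theorem expect_add (n : ℕ) (φ ψ : List Stage → ℝ) :
    expect p θ₀ σ τ n (fun h => φ h + ψ h) = expect p θ₀ σ τ n φ + expect p θ₀ σ τ n ψ := by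
  simp only [expect, mul_add, Finset.sum_add_distrib]

theorem expect_sub (n : ℕ) (φ ψ : List Stage → ℝ) :
    expect p θ₀ σ τ n (fun h => φ h - ψ h) = expect p θ₀ σ τ n φ - expect p θ₀ σ τ n ψ := by
  simp only [expect, mul_sub, Finset.sum_sub_distrib]

theorem expect_const (n : ℕ) (c : ℝ) : expect p θ₀ σ τ n (fun _ => c) = c := by
  induction n with
  | zero => rw [expect_zero]
  | succ n ih => simp only [expect_succ, nextExpect_const, ih]

theorem totalGain_zero : totalGain p θ₀ σ τ 0 = 0 := expect_zero p θ₀ σ τ _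

theorem totalGain_succ (n : ℕ) : totalGain p θ₀ σ τ (n + 1) =
    totalGain p θ₀ σ τ n + expect p θ₀ σ τ n fun h => nextExpect p θ₀ σ τ h gain := by
  simp only [totalGain, expect_succ, List.map_cons, List.sum_cons, nextExpect_add,
    nextExpect_const, expect_add]
  exact add_comm _ _

theorem totalGain_add_expect (Φ : List Stage → ℝ) (n : ℕ) :
    totalGain p θ₀ σ τ n + expect p θ₀ σ τ n Φ =
      Φ [] + ∑ k ∈ Finset.range n, expect p θ₀ σ τ k (drift p θ₀ σ τ Φ) := by
  induction n with
  | zero => simp [totalGain_zero, expect_zero]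
  | succ n ih =>
    have hdrift : expect p θ₀ σ τ n (drift p θ₀ σ τ Φ) + expect p θ₀ σ τ n Φ =
        (expect p θ₀ σ τ n fun h => nextExpect p θ₀ σ τ h gain) +
          expect p θ₀ σ τ (n + 1) Φ := by
      simp only [← expect_add, expect_succ, drift, nextExpect_add, sub_add_cancel]
    rw [totalGain_succ, Finset.sum_range_succ]
    linarith

end Expectation

section LongRun

variable {p θ₀ : unitInterval} {σ : Strategy1} {τ : Strategy2}

theorem nextProb_nonneg (h : List Stage) (x : Stage) : 0 ≤ nextProb p θ₀ σ τ h x :=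
  mul_nonneg (mul_nonneg (stateProb_nonneg _ _ _ _) (moveProb1_nonneg _ _)) (moveProb2_nonneg _ _)

theorem playProb_nonneg (h : List Stage) : 0 ≤ playProb p θ₀ σ τ h := by
  induction h with
  | nil => exact zero_le_one
  | cons x h ih =>
    exact mul_nonneg (mul_nonneg (mul_nonneg ih (stateProb_nonneg _ _ _ _))
      (moveProb1_nonneg _ _)) (moveProb2_nonneg _ _)

theorem nextExpect_mono (h : List Stage) {f g : Stage → ℝ} (hfg : ∀ x, f x ≤ g x) :
    nextExpect p θ₀ σ τ h f ≤ nextExpect p θ₀ σ τ h g :=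
  Finset.sum_le_sum fun x _ => mul_le_mul_of_nonneg_left (hfg x) (nextProb_nonneg h x)

theorem expect_mono (n : ℕ) {φ ψ : List Stage → ℝ} (h : ∀ l, φ l ≤ ψ l) :
    expect p θ₀ σ τ n φ ≤ expect p θ₀ σ τ n ψ :=
  Finset.sum_le_sum fun _ _ => mul_le_mul_of_nonneg_left (h _) (playProb_nonneg _)

theorem expect_le_of_forall_le (n : ℕ) {φ : List Stage → ℝ} {c : ℝ} (h : ∀ l, φ l ≤ c) :
    expect p θ₀ σ τ n φ ≤ c :=
  (expect_mono n h).trans_eq (expect_const _ _ _ _ n c)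

theorem le_expect_of_forall_le (n : ℕ) {φ : List Stage → ℝ} {c : ℝ} (h : ∀ l, c ≤ φ l) :
    c ≤ expect p θ₀ σ τ n φ :=
  (expect_const _ _ _ _ n c).symm.trans_le (expect_mono n h)

theorem totalGain_le_of_drift_le {Φ : List Stage → ℝ} {C v : ℝ} (hΦ : ∀ h, |Φ h| ≤ C)
    (hv : ∀ k, expect p θ₀ σ τ k (drift p θ₀ σ τ Φ) ≤ v) (n : ℕ) :
    totalGain p θ₀ σ τ n ≤ n * v + 2 * C := by
  have hsum := Finset.sum_le_card_nsmul (Finset.range n) _ v fun k _ => hv k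
  rw [Finset.card_range, nsmul_eq_mul] at hsum
  have hlow := le_expect_of_forall_le (p := p) (θ₀ := θ₀) (σ := σ) (τ := τ) n
    fun h => (abs_le.1 (hΦ h)).1
  linarith [totalGain_add_expect p θ₀ σ τ Φ n, (abs_le.1 (hΦ [])).2]

theorem le_totalGain_of_le_drift {Φ : List Stage → ℝ} {C v : ℝ} (hΦ : ∀ h, |Φ h| ≤ C)
    (hv : ∀ k, v ≤ expect p θ₀ σ τ k (drift p θ₀ σ τ Φ)) (n : ℕ) :
    n * v - 2 * C ≤ totalGain p θ₀ σ τ n := by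
  have hsum := Finset.card_nsmul_le_sum (Finset.range n) _ v fun k _ => hv k
  rw [Finset.card_range, nsmul_eq_mul] at hsum
  have hup := expect_le_of_forall_le (p := p) (θ₀ := θ₀) (σ := σ) (τ := τ) n
    fun h => (abs_le.1 (hΦ h)).2
  linarith [totalGain_add_expect p θ₀ σ τ Φ n, (abs_le.1 (hΦ [])).1]

theorem gain_mem_Icc (x : Stage) : gain x ∈ Set.Icc (0 : ℝ) 1 := by
  rcases x with ⟨_ | _, _ | _, _ | _⟩ <;> norm_num [gain]

theorem avgGain_mem_Icc (n : ℕ) : avgGain p θ₀ σ τ n ∈ Set.Icc (0 : ℝ) 1 := by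
  have hlow := le_totalGain_of_le_drift (p := p) (θ₀ := θ₀) (σ := σ) (τ := τ)
    (Φ := fun _ => 0) (v := 0) (fun _ => abs_zero.le)
    (fun k => le_expect_of_forall_le k fun h => by
      simpa [drift, nextExpect_const] using nextExpect_mono h fun x => (gain_mem_Icc x).1) n
  have hup := totalGain_le_of_drift_le (p := p) (θ₀ := θ₀) (σ := σ) (τ := τ)
    (Φ := fun _ => 0) (v := 1) (fun _ => abs_zero.le)
    (fun k => expect_le_of_forall_le k fun h => by
      simpa [drift, nextExpect_const] using nextExpect_mono h fun x => (gain_mem_Icc x).2) n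
  rw [avgGain_eq_totalGain_div]
  exact ⟨div_nonneg (by linarith) n.cast_nonneg, div_le_one_of_le₀ (by linarith) n.cast_nonneg⟩

theorem isBoundedUnder_le_avgGain : IsBoundedUnder (· ≤ ·) atTop (avgGain p θ₀ σ τ) :=
  isBoundedUnder_of ⟨1, fun n => (avgGain_mem_Icc n).2⟩

theorem isBoundedUnder_ge_avgGain : IsBoundedUnder (· ≥ ·) atTop (avgGain p θ₀ σ τ) :=
  isBoundedUnder_of ⟨0, fun n => (avgGain_mem_Icc n).1⟩

theorem tendsto_const_add_div_atTop (v C : ℝ) :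
    Tendsto (fun n : ℕ => v + C / n) atTop (nhds v) := by
  simpa using (tendsto_const_div_atTop_nhds_zero_nat C).const_add v

theorem le_liminf_avgGain_of_le_drift {Φ : List Stage → ℝ} {C v : ℝ} (hΦ : ∀ h, |Φ h| ≤ C)
    (hv : ∀ k, v ≤ expect p θ₀ σ τ k (drift p θ₀ σ τ Φ)) :
    v ≤ liminf (avgGain p θ₀ σ τ) atTop := by
  have hlim := tendsto_const_add_div_atTop v (-(2 * C))
  rw [← hlim.liminf_eq]
  refine liminf_le_liminf ?_ hlim.isBoundedUnder_ge
    isBoundedUnder_le_avgGain.isCoboundedUnder_ge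
  filter_upwards [eventually_gt_atTop 0] with n hn
  have hn' : (0 : ℝ) < n := by exact_mod_cast hn
  rw [avgGain_eq_totalGain_div, le_div_iff₀ hn', add_mul, div_mul_cancel₀ _ hn'.ne']
  linarith [le_totalGain_of_le_drift hΦ hv n]

theorem limsup_avgGain_le_of_drift_le {Φ : List Stage → ℝ} {C v : ℝ} (hΦ : ∀ h, |Φ h| ≤ C)
    (hv : ∀ k, expect p θ₀ σ τ k (drift p θ₀ σ τ Φ) ≤ v) :
    limsup (avgGain p θ₀ σ τ) atTop ≤ v := by
  have hlim := tendsto_const_add_div_atTop v (2 * C)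
  rw [← hlim.limsup_eq]
  refine limsup_le_limsup ?_ isBoundedUnder_ge_avgGain.isCoboundedUnder_le
    hlim.isBoundedUnder_le
  filter_upwards [eventually_gt_atTop 0] with n hn
  have hn' : (0 : ℝ) < n := by exact_mod_cast hn
  rw [avgGain_eq_totalGain_div, div_le_iff₀ hn', add_mul, div_mul_cancel₀ _ hn'.ne']
  linarith [totalGain_le_of_drift_le hΦ hv n]

theorem liminf_avgGain_le_limsup_avgGain :
    liminf (avgGain p θ₀ σ τ) atTop ≤ limsup (avgGain p θ₀ σ τ) atTop :=
  liminf_le_limsup isBoundedUnder_le_avgGain isBoundedUnder_ge_avgGain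

end LongRun

/-! ### Equalizing strategies of Player 1 and certificates of Player 2 -/

/-- The internal state of a player who updates it by `U` according to the moves of Player 1. -/
def memory {Ω : Type*} (U : Ω → Move1 → Ω) (ω : Ω) : List (Move1 × Move2) → Ω
  | [] => ω
  | (a, _) :: l => U (memory U ω l) a

/-- The probability of each state under the belief that the state is `low` with probability `θ`. -/
def beliefProb (θ : unitInterval) : State → ℝ
  | State.low => θ
  | State.high => 1 - θ

/-- A strategy of Player 1 driven by the belief `θ` of Player 2, such that the expected gain
`stageGain θ` of a stage does not depend on the move of Player 2. Being equalizing forces Player 1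
to play `T` with total probability `1 - θ`; `update_top` and `update_bottom` are Bayes' rule
multiplied by the probability of the move, so they say nothing after a move of probability `0`. -/
structure EqualizingStrategy (p : ℝ) where
  /-- The probability of playing `T`. -/
  play : unitInterval → State → unitInterval
  /-- The belief after a move of Player 1. -/
  update : unitInterval → Move1 → unitInterval
  /-- The expected gain of a stage. -/
  stageGain : unitInterval → ℝ
  gain_left (θ : unitInterval) : θ * play θ State.low = stageGain θ
  gain_right (θ : unitInterval) : (1 - θ) * (1 - play θ State.high) = stageGain θ
  update_top (θ : unitInterval) : (1 - θ) * (update θ Move1.T : ℝ) =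
    p * stageGain θ + (1 - p) * (1 - θ - stageGain θ)
  update_bottom (θ : unitInterval) : θ * (update θ Move1.B : ℝ) =
    p * (θ - stageGain θ) + (1 - p) * stageGain θ

namespace EqualizingStrategy

/-- The strategy in the repeated game with initial belief `θ₀`. -/
def strategy {p : ℝ} (E : EqualizingStrategy p) (θ₀ : unitInterval) : Strategy1 :=
  fun h => E.play (memory E.update θ₀ (publicPast h))

/-- Expected gain plus increase of the potential `H` in one stage at belief `θ`. -/
noncomputable def beliefDrift {p : ℝ} (E : EqualizingStrategy p) (H : unitInterval → ℝ)
    (θ : unitInterval) : ℝ :=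
  E.stageGain θ + (1 - θ) * H (E.update θ Move1.T) + θ * H (E.update θ Move1.B) - H θ

theorem sum_beliefProb_update {p : ℝ} (E : EqualizingStrategy p) (θ : unitInterval)
    (f : Move1 → State → ℝ) :
    ∑ s, beliefProb θ s * ∑ a, moveProb1 (E.play θ s) a *
        ∑ s', beliefProb (E.update θ a) s' * f a s' =
      ∑ s, beliefProb θ s * ∑ a, moveProb1 (E.play θ s) a * ∑ s', transProb p s s' * f a s' := by
  have hleft := E.gain_left θ
  have hright := E.gain_right θ
  have htop : (θ * E.play θ State.low + (1 - θ) * E.play θ State.high) * E.update θ Move1.T =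
      p * (θ * E.play θ State.low) + (1 - p) * ((1 - θ) * E.play θ State.high) := by
    linear_combination E.update_top θ + (E.update θ Move1.T - p) * hleft -
      (E.update θ Move1.T - (1 - p)) * hright
  have hbottom : (θ * (1 - E.play θ State.low) + (1 - θ) * (1 - E.play θ State.high)) *
      E.update θ Move1.B = p * (θ * (1 - E.play θ State.low)) +
        (1 - p) * ((1 - θ) * (1 - E.play θ State.high)) := by
    linear_combination E.update_bottom θ - (E.update θ Move1.B - p) * hleft +
      (E.update θ Move1.B - (1 - p)) * hright
  simp only [sum_state, sum_move1, beliefProb, moveProb1, transProb, if_true, reduceCtorEq,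
    if_false]
  linear_combination (f Move1.T State.low - f Move1.T State.high) * htop +
    (f Move1.B State.low - f Move1.B State.high) * hbottom

theorem expect_sum_stateProb_mul {p : ℝ} (E : EqualizingStrategy p) (θ₀ : unitInterval)
    (τ : Strategy2) (n : ℕ) (ψ : List (Move1 × Move2) → State → ℝ) :
    expect p θ₀ (E.strategy θ₀) τ n
        (fun h => ∑ s, stateProb p θ₀ h s * ψ (publicPast h) s) =
      expect p θ₀ (E.strategy θ₀) τ n
        (fun h => ∑ s, beliefProb (memory E.update θ₀ (publicPast h)) s * ψ (publicPast h) s) := by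
  induction n generalizing ψ with
  | zero => simp only [expect_zero, sum_state, stateProb, beliefProb, memory, List.map_nil]
  | succ n ih =>
    let next (l : List (Move1 × Move2)) (a : Move1) (s : State) : ℝ :=
      ∑ b, moveProb2 (τ l) b * ψ ((a, b) :: l) s
    have hpast := ih fun l s => ∑ a, moveProb1 (E.play (memory E.update θ₀ l) s) a *
      ∑ s', transProb p s s' * next l a s'
    have hbelief := ih fun l s => ∑ a, moveProb1 (E.play (memory E.update θ₀ l) s) a *
      ∑ s', beliefProb (E.update (memory E.update θ₀ l) a) s' * next l a s'
    simp only [sum_beliefProb_update] at hbelief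
    rw [expect_succ, expect_succ]
    convert hpast.trans hbelief.symm using 2 <;>
    · funext h
      simp only [nextExpect_eq_sum_state, sum_state, sum_move1, sum_move2, next, strategy,
        stateProb_cons, List.map_cons, memory]
      ring

theorem expect_drift {p : ℝ} (E : EqualizingStrategy p) (H : unitInterval → ℝ)
    (θ₀ : unitInterval) (τ : Strategy2) (n : ℕ) :
    expect p θ₀ (E.strategy θ₀) τ n
        (drift p θ₀ (E.strategy θ₀) τ fun h => H (memory E.update θ₀ (publicPast h))) =
      expect p θ₀ (E.strategy θ₀) τ n
        (fun h => E.beliefDrift H (memory E.update θ₀ (publicPast h))) := by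
  have hmean := E.expect_sum_stateProb_mul θ₀ τ n fun l s =>
    ∑ a, ∑ b, moveProb1 (E.play (memory E.update θ₀ l) s) a * moveProb2 (τ l) b *
      (gain (s, a, b) + H (E.update (memory E.update θ₀ l) a))
  unfold drift
  simp only [expect_sub, nextExpect_eq_sum_state]
  refine (congrArg (· - _) hmean).trans ?_
  rw [← expect_sub]
  congr 1
  funext h
  set θ := memory E.update θ₀ (publicPast h)
  simp only [sum_state, sum_move1, sum_move2, beliefProb, moveProb1, moveProb2, gain, beliefDrift]
  linear_combination (τ (publicPast h) + H (E.update θ Move1.T) - H (E.update θ Move1.B)) *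
    E.gain_left θ + (1 - τ (publicPast h) - H (E.update θ Move1.T) + H (E.update θ Move1.B)) *
    E.gain_right θ

theorem guarantees1 {p : unitInterval} (E : EqualizingStrategy p) {H : unitInterval → ℝ}
    {C v : ℝ} (hH : ∀ θ, |H θ| ≤ C) (hv : ∀ θ, v ≤ E.beliefDrift H θ) (θ₀ : unitInterval) :
    Guarantees1 p θ₀ (E.strategy θ₀) v := fun τ =>
  le_liminf_avgGain_of_le_drift (fun _ => hH _) fun k => by
    rw [expect_drift]
    exact le_expect_of_forall_le k fun _ => hv _

theorem le_of_guarantees1 {p : unitInterval} (E : EqualizingStrategy p) {H : unitInterval → ℝ}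
    {C v v' : ℝ} (hH : ∀ θ, |H θ| ≤ C) (hv : ∀ θ, E.beliefDrift H θ ≤ v) {θ₀ : unitInterval}
    (h : Guarantees1 p θ₀ (E.strategy θ₀) v') : v' ≤ v := by
  have hlimsup : limsup (avgGain p θ₀ (E.strategy θ₀) fun _ => 0) atTop ≤ v :=
    limsup_avgGain_le_of_drift_le (fun _ => hH _) fun k => by
      rw [expect_drift]
      exact expect_le_of_forall_le k fun _ => hv _
  exact (h _).trans (liminf_avgGain_le_limsup_avgGain.trans hlimsup)

end EqualizingStrategy

theorem abs_sum_stateProb_mul_le {p θ₀ : unitInterval} (h : List Stage) {f : State → ℝ} {C : ℝ}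
    (hf : ∀ s, |f s| ≤ C) : |∑ s, stateProb p θ₀ h s * f s| ≤ C :=
  calc |∑ s, stateProb p θ₀ h s * f s|
      ≤ ∑ s, |stateProb p θ₀ h s * f s| := Finset.abs_sum_le_sum_abs _ _
    _ ≤ ∑ s, stateProb p θ₀ h s * C := Finset.sum_le_sum fun s _ => by
        rw [abs_mul, abs_of_nonneg (stateProb_nonneg p θ₀ h s)]
        exact mul_le_mul_of_nonneg_left (hf s) (stateProb_nonneg p θ₀ h s)
    _ = C := by rw [← Finset.sum_mul, sum_stateProb, one_mul]

theorem guarantees2_of_potential {Ω : Type*} {p : unitInterval} (θ₀ : unitInterval) {v C : ℝ}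
    {U : Ω → Move1 → Ω} (ω₀ : Ω) {α : Ω → State → ℝ} {y : Ω → unitInterval}
    (hα : ∀ ω s, |α ω s| ≤ C)
    (hv : ∀ ω s a, ∑ b, moveProb2 (y ω) b * gain (s, a, b) +
      ∑ s', transProb p s s' * α (U ω a) s' ≤ α ω s + v) :
    Guarantees2 p θ₀ (fun l => y (memory U ω₀ l)) v := by
  intro σ
  refine limsup_avgGain_le_of_drift_le
    (Φ := fun h => ∑ s, stateProb p θ₀ h s * α (memory U ω₀ (publicPast h)) s)
    (fun h => abs_sum_stateProb_mul_le h (hα _)) fun k => expect_le_of_forall_le k fun h => ?_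
  set ω := memory U ω₀ (publicPast h)
  rw [drift, sub_le_iff_le_add']
  calc nextExpect p θ₀ σ (fun l => y (memory U ω₀ l)) h _
      = ∑ s, stateProb p θ₀ h s * ∑ a, moveProb1 (σ h s) a *
          (∑ b, moveProb2 (y ω) b * gain (s, a, b) + ∑ s', transProb p s s' * α (U ω a) s') := by
        simp only [nextExpect_eq_sum_state, sum_state, sum_move1, sum_move2, stateProb_cons,
          List.map_cons, memory, moveProb2, ω]
        ring
    _ ≤ ∑ s, stateProb p θ₀ h s * ∑ a, moveProb1 (σ h s) a * (α ω s + v) := by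
        refine Finset.sum_le_sum fun s _ => mul_le_mul_of_nonneg_left ?_ (stateProb_nonneg p θ₀ h s)
        exact Finset.sum_le_sum fun a _ =>
          mul_le_mul_of_nonneg_left (hv ω s a) (moveProb1_nonneg _ a)
    _ = ∑ s, stateProb p θ₀ h s * α ω s + v := by
        simp only [← Finset.sum_mul, sum_moveProb1, one_mul, mul_add, Finset.sum_add_distrib,
          sum_stateProb]

/-- Data from which Player 2 builds a strategy: for every number `k` of non-revealing moves since
the last revealing one, an affine function of the folded belief, given by its values `u k` at
`1 - p` and `w k` at `p`, such that these functions satisfy the recursion of the expected time until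
`σ*` reveals the state. `keep k` tells whether folding leaves the belief after the `k`-th
non-revealing move unchanged. -/
structure RevealCertificate (p : ℝ) where
  keep : ℕ → Bool
  u : ℕ → ℝ
  w : ℕ → ℝ
  u_eq (k : ℕ) : u k = 1 + (2 * p - 1) * cond (keep k) (u (k + 1)) (w (k + 1)) +
    (1 - p) * cond (keep k) (w (k + 1)) (u (k + 1))
  w_eq (k : ℕ) : w k = 1 - (2 * p - 1) * cond (keep k) (u (k + 1)) (w (k + 1)) +
    p * cond (keep k) (w (k + 1)) (u (k + 1))
  u_zero_pos : 0 < u 0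
  u_nonneg (k : ℕ) : 0 ≤ u k
  w_nonneg (k : ℕ) : 0 ≤ w k
  u_le (k : ℕ) : u k ≤ u 0
  w_le (k : ℕ) : w k ≤ u 0
  abs_sub_le (k : ℕ) : |u k - w k| ≤ w 0

namespace RevealCertificate

/-- The expected time until `σ*` reveals the state, given the actual state. The `Bool` is `true`
if the folded belief is the probability of `low`, and `false` if it is that of `high`. -/
def stateTime {p : ℝ} (Z : RevealCertificate p) : ℕ × Bool → State → ℝ
  | (k, true), State.high | (k, false), State.low =>
      1 + cond (Z.keep k) (Z.u (k + 1)) (Z.w (k + 1))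
  | (k, true), State.low | (k, false), State.high =>
      1 + cond (Z.keep k) (Z.w (k + 1)) (Z.u (k + 1)) -
        cond (Z.keep k) (Z.u (k + 1)) (Z.w (k + 1))

/-- The internal state of Player 2 after a move of Player 1, in the encoding of `stateTime`. -/
def update {p : ℝ} (Z : RevealCertificate p) : ℕ × Bool → Move1 → ℕ × Bool
  | (k, true), Move1.T => (k + 1, Z.keep k)
  | (_, true), Move1.B => (0, true)
  | (_, false), Move1.T => (0, false)
  | (k, false), Move1.B => (k + 1, !Z.keep k)

theorem sum_transProb_mul_stateTime {p : ℝ} (Z : RevealCertificate p) (k : ℕ) (o : Bool)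
    (s : State) : ∑ s', transProb p s s' * Z.stateTime (k, o) s' =
      if o = decide (s = State.low) then Z.w k else Z.u k := by
  have hu := Z.u_eq k
  have hw := Z.w_eq k
  rcases o with _ | _ <;> rcases s with _ | _ <;>
    simp only [sum_state, transProb, stateTime, reduceCtorEq, decide_true, decide_false, if_true,
      if_false, Bool.false_eq_true, Bool.true_eq_false] <;>
    linarith

theorem cond_mem_Icc {p : ℝ} (Z : RevealCertificate p) (b : Bool) (k : ℕ) :
    cond b (Z.u k) (Z.w k) ∈ Set.Icc 0 (Z.u 0) := by
  cases b
  exacts [⟨Z.w_nonneg k, Z.w_le k⟩, ⟨Z.u_nonneg k, Z.u_le k⟩]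

theorem abs_cond_sub_cond_le {p : ℝ} (Z : RevealCertificate p) (b : Bool) (k : ℕ) :
    |cond b (Z.w k) (Z.u k) - cond b (Z.u k) (Z.w k)| ≤ Z.w 0 := by
  cases b
  exacts [Z.abs_sub_le k, (abs_sub_comm _ _).trans_le (Z.abs_sub_le k)]

theorem abs_stateTime_le {p : ℝ} (Z : RevealCertificate p) (ω : ℕ × Bool) (s : State) :
    |Z.stateTime ω s| ≤ 1 + Z.u 0 := by
  obtain ⟨k, o⟩ := ω
  obtain ⟨hnonneg, hle⟩ := Z.cond_mem_Icc (Z.keep k) (k + 1)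
  obtain ⟨hlow, hup⟩ := abs_le.1 (Z.abs_cond_sub_cond_le (Z.keep k) (k + 1))
  have hw := Z.w_le 0
  rw [abs_le]
  rcases o with _ | _ <;> rcases s with _ | _ <;> simp only [stateTime] <;>
    constructor <;> linarith

/-- The probability with which Player 2 plays `L`. -/
noncomputable def play {p : ℝ} (Z : RevealCertificate p) (ω : ℕ × Bool) : unitInterval :=
  have hmem := Z.cond_mem_Icc (Z.keep ω.1) (ω.1 + 1)
  let y : unitInterval := ⟨cond (Z.keep ω.1) (Z.u (ω.1 + 1)) (Z.w (ω.1 + 1)) / Z.u 0,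
    div_nonneg hmem.1 Z.u_zero_pos.le, (div_le_one Z.u_zero_pos).2 hmem.2⟩
  cond ω.2 y (unitInterval.symm y)

theorem guarantees2 {p : unitInterval} (Z : RevealCertificate p) (θ₀ : unitInterval) :
    Guarantees2 p θ₀ (fun l => Z.play (memory Z.update (0, true) l)) (Z.u 0)⁻¹ := by
  set v := (Z.u 0)⁻¹ with hv
  have hv0 : 0 ≤ v := (inv_pos.2 Z.u_zero_pos).le
  have hvu : v * Z.u 0 = 1 := inv_mul_cancel₀ Z.u_zero_pos.ne'
  refine guarantees2_of_potential θ₀ (0, true) (C := 1 + v * (1 + Z.u 0))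
    (α := fun ω s => 1 - v * Z.stateTime ω s) (fun ω s => ?_) fun ⟨k, o⟩ s a => ?_
  · refine (abs_sub _ _).trans ?_
    rw [abs_one, abs_mul, abs_of_nonneg hv0]
    gcongr
    exact Z.abs_stateTime_le ω s
  · have hpot : ∀ k o s, ∑ s', transProb p s s' * (1 - v * Z.stateTime (k, o) s') =
        1 - v * if o = decide (s = State.low) then Z.w k else Z.u k := by
      intro k o s
      rw [← sum_transProb_mul_stateTime, sum_state, sum_state]
      cases s <;> simp only [transProb, reduceCtorEq, if_true, if_false] <;> ring
    have hjump := mul_le_mul_of_nonneg_left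
      (abs_le.1 (Z.abs_cond_sub_cond_le (Z.keep k) (k + 1))).2 hv0
    rcases o with _ | _ <;> rcases s with _ | _ <;> rcases a with _ | _ <;>
      rcases hkeep : Z.keep k with _ | _ <;>
      simp only [update, hpot, hkeep, decide_true, decide_false, reduceCtorEq, Bool.not_true,
        Bool.not_false, Bool.false_eq_true, Bool.true_eq_false, if_true, if_false] <;>
      simp only [sum_move2, moveProb2, gain, stateTime, play, hkeep, cond_true, cond_false,
        unitInterval.coe_symm_eq, div_eq_mul_inv, ← hv] at hjump ⊢ <;>
      linarith

end RevealCertificate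

/-! ### The strategy σ* and the expected reveal time -/

/-- The distance of a belief to certainty. -/
def foldBelief (θ : ℝ) : ℝ := min θ (1 - θ)

theorem foldBelief_of_le {θ : ℝ} (h : θ ≤ 1 / 2) : foldBelief θ = θ :=
  min_eq_left (by linarith)

theorem foldBelief_of_ge {θ : ℝ} (h : 1 / 2 ≤ θ) : foldBelief θ = 1 - θ :=
  min_eq_right (by linarith)

theorem foldBelief_one_sub (θ : ℝ) : foldBelief (1 - θ) = foldBelief θ := by
  rw [foldBelief, foldBelief, min_comm, sub_sub_cancel]

theorem foldBelief_le_half (θ : ℝ) : foldBelief θ ≤ 1 / 2 := by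
  rcases le_total θ (1 / 2) with h | h
  · rwa [foldBelief_of_le h]
  · rw [foldBelief_of_ge h]
    linarith

theorem foldBelief_mem_Icc (θ : unitInterval) : foldBelief θ ∈ Set.Icc (0 : ℝ) (1 / 2) :=
  ⟨le_min θ.2.1 (by linarith [θ.2.2]), foldBelief_le_half _⟩

/-- The folded belief after a transition, for the belief `t` before it. -/
def foldStep (p t : ℝ) : ℝ := foldBelief (1 - p + (2 * p - 1) * t)

theorem foldStep_mem_Icc {p t : ℝ} (hp : 1 / 2 ≤ p) (ht : t ∈ unitInterval) :
    foldStep p t ∈ Set.Icc (1 - p) (1 / 2) :=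
  ⟨le_min (by nlinarith [ht.1]) (by nlinarith [ht.2]), foldBelief_le_half _⟩

theorem foldStep_of_ge {p t : ℝ} (hp : 1 / 2 ≤ p) (ht : 1 / 2 ≤ t) :
    foldStep p t = p - (2 * p - 1) * t := by
  rw [foldStep, foldBelief_of_ge (by nlinarith)]
  ring

theorem foldStep_one {p : ℝ} (hp : 1 / 2 ≤ p) : foldStep p 1 = 1 - p := by
  rw [foldStep_of_ge hp (by norm_num)]
  ring

/-- The effect of a move of `σ*` that does not reveal the state on the folded belief. -/
noncomputable def foldMap (p x : ℝ) : ℝ := foldStep p (x / (1 - x))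

theorem div_one_sub_mem_unitInterval {x : ℝ} (hx : x ∈ Set.Icc (0 : ℝ) (1 / 2)) :
    x / (1 - x) ∈ unitInterval :=
  unitInterval.div_mem hx.1 (by linarith [hx.2]) (by linarith [hx.2])

theorem foldMap_mem_Icc {p x : ℝ} (hp : 1 / 2 ≤ p) (hx : x ∈ Set.Icc (0 : ℝ) (1 / 2)) :
    foldMap p x ∈ Set.Icc (1 - p) (1 / 2) :=
  foldStep_mem_Icc hp (div_one_sub_mem_unitInterval hx)

theorem foldMap_of_le {p x : ℝ} (hp : 1 / 2 ≤ p) (hx : x ≤ 1 / 3) :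
    foldMap p x = 1 - p + (2 * p - 1) * (x / (1 - x)) := by
  have : x / (1 - x) ≤ 1 / 2 := by
    rw [div_le_iff₀ (by linarith)]
    linarith
  exact foldBelief_of_le (by nlinarith)

theorem foldMap_of_ge {p x : ℝ} (hp : 1 / 2 ≤ p) (hx : 1 / 3 ≤ x) (hx1 : x < 1) :
    foldMap p x = p - (2 * p - 1) * (x / (1 - x)) :=
  foldStep_of_ge hp ((le_div_iff₀ (by linarith)).2 (by linarith))

namespace EqualizingStrategy

theorem foldBelief_update_top {p : ℝ} (E : EqualizingStrategy p) {θ : unitInterval}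
    (hθ : 1 - (θ : ℝ) ≠ 0) :
    foldBelief (E.update θ Move1.T) = foldStep p (E.stageGain θ / (1 - θ)) := by
  rw [foldStep]
  congr 1
  field_simp
  linear_combination E.update_top θ

theorem foldBelief_update_bottom {p : ℝ} (E : EqualizingStrategy p) {θ : unitInterval}
    (hθ : (θ : ℝ) ≠ 0) :
    foldBelief (E.update θ Move1.B) = foldStep p (E.stageGain θ / θ) := by
  rw [foldStep, ← foldBelief_one_sub]
  congr 1
  field_simp
  linear_combination -E.update_bottom θ

theorem beliefDrift_foldBelief {p : ℝ} (E : EqualizingStrategy p) (H : ℝ → ℝ)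
    (θ : unitInterval) :
    E.beliefDrift (fun θ => H (foldBelief θ)) θ =
      E.stageGain θ + (1 - foldBelief θ) * H (foldStep p (E.stageGain θ / (1 - foldBelief θ))) +
        foldBelief θ * H (foldStep p (E.stageGain θ / foldBelief θ)) - H (foldBelief θ) := by
  have htop : (1 - (θ : ℝ)) * H (foldBelief (E.update θ Move1.T)) =
      (1 - θ) * H (foldStep p (E.stageGain θ / (1 - θ))) := by
    rcases eq_or_ne (1 - (θ : ℝ)) 0 with h | h
    · simp only [h, zero_mul]
    · rw [E.foldBelief_update_top h]
  have hbottom : (θ : ℝ) * H (foldBelief (E.update θ Move1.B)) =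
      θ * H (foldStep p (E.stageGain θ / θ)) := by
    rcases eq_or_ne (θ : ℝ) 0 with h | h
    · simp only [h, zero_mul]
    · rw [E.foldBelief_update_bottom h]
  simp only [beliefDrift, htop, hbottom]
  rcases le_total (θ : ℝ) (1 / 2) with h | h
  · simp only [foldBelief_of_le h]
  · simp only [foldBelief_of_ge h, sub_sub_cancel]
    ring

theorem stageGain_mem_Icc {p : ℝ} (E : EqualizingStrategy p) (θ : unitInterval) :
    E.stageGain θ ∈ Set.Icc 0 (foldBelief θ) := by
  have hlow := (E.play θ State.low).2
  have hhigh := (E.play θ State.high).2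
  have hleft := E.gain_left θ
  have hright := E.gain_right θ
  exact ⟨by nlinarith [θ.2.1, hlow.1],
    le_min (by nlinarith [θ.2.1, hlow.2]) (by nlinarith [θ.2.2, hhigh.1])⟩

theorem beliefDrift_of_stageGain_eq {p : ℝ} (hp : 1 / 2 ≤ p) (E : EqualizingStrategy p)
    (H : ℝ → ℝ) {θ : unitInterval} (hθ : E.stageGain θ = foldBelief θ) :
    E.beliefDrift (fun θ => H (foldBelief θ)) θ =
      foldBelief θ + (1 - foldBelief θ) * H (foldMap p (foldBelief θ)) +
        foldBelief θ * H (1 - p) - H (foldBelief θ) := by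
  rw [E.beliefDrift_foldBelief, hθ, foldMap]
  rcases eq_or_ne (foldBelief θ) 0 with h | h
  · simp only [h, zero_mul]
  · rw [div_self h, foldStep_one hp]

end EqualizingStrategy

/-- The strategy `σ*` as an equalizing strategy. -/
noncomputable def star (p : unitInterval) : EqualizingStrategy p where
  play θ s := ⟨playTReal θ s, playTReal_mem θ s⟩
  update θ a := ⟨updateReal p θ a, updateReal_mem p θ a⟩
  stageGain θ := foldBelief θ
  gain_left θ := by
    rcases le_or_gt (θ : ℝ) (1 / 2) with h | h
    · simp only [playTReal, if_pos h, foldBelief_of_le h, mul_one]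
    · simp only [playTReal, if_neg h.not_ge, foldBelief_of_ge h.le]
      exact mul_div_cancel₀ _ (by linarith)
  gain_right θ := by
    rcases le_or_gt (θ : ℝ) (1 / 2) with h | h
    · have : 1 - (θ : ℝ) ≠ 0 := by linarith
      simp only [playTReal, if_pos h, foldBelief_of_le h]
      field_simp
      ring
    · simp only [playTReal, if_neg h.not_ge, foldBelief_of_ge h.le, sub_zero, mul_one]
  update_top θ := by
    rcases lt_or_ge (θ : ℝ) (1 / 2) with h | h
    · have : 1 - (θ : ℝ) ≠ 0 := by linarith
      simp only [updateReal, if_neg h.not_ge, foldBelief_of_le h.le]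
      field_simp
      ring
    · simp only [updateReal, if_pos h, foldBelief_of_ge h]
      ring
  update_bottom θ := by
    rcases lt_or_ge (θ : ℝ) (1 / 2) with h | h
    · simp only [updateReal, if_neg h.not_ge, foldBelief_of_le h.le]
      ring
    · have : (θ : ℝ) ≠ 0 := by linarith
      simp only [updateReal, if_pos h, foldBelief_of_ge h]
      field_simp
      ring

theorem belief_eq_memory (p θ₀ : unitInterval) (h : List Stage) :
    belief p θ₀ h = memory (star p).update θ₀ (publicPast h) := by
  induction h with
  | nil => rfl
  | cons x h ih => exact congrArg (fun θ => (star p).update θ x.2.1) ih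

theorem sigmaStar_eq_strategy_star (p θ₀ : unitInterval) :
    sigmaStar p θ₀ = (star p).strategy θ₀ :=
  funext fun h => funext fun s => congrArg (fun θ => (star p).play θ s) (belief_eq_memory p θ₀ h)

/-- `ℓ x` is the expected time until `σ*` reveals the state, starting from the folded belief `x`;
only the folded beliefs that can occur after the first stage are considered. -/
structure IsRevealTime (p : ℝ) (ℓ : ℝ → ℝ) : Prop where
  eq_one_add : ∀ x ∈ Set.Icc (1 - p) (1 / 2), ℓ x = 1 + (1 - x) * ℓ (foldMap p x)
  bounded : ∃ C, ∀ x ∈ Set.Icc (1 - p) (1 / 2), |ℓ x| ≤ C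

/-- The potential of `σ*` in the game with stage payoff `gain - v`. Its factor of `-v` is the
expected reveal time, written so as to make sense at the initial belief. -/
noncomputable def starPotential (p v : ℝ) (ℓ : ℝ → ℝ) (x : ℝ) : ℝ :=
  1 - v * (1 + (1 - x) * ℓ (foldMap p x))

theorem IsRevealTime.starPotential_eq {p v : ℝ} {ℓ : ℝ → ℝ} (hℓ : IsRevealTime p ℓ) {x : ℝ}
    (hx : x ∈ Set.Icc (1 - p) (1 / 2)) : starPotential p v ℓ x = 1 - v * ℓ x := by
  rw [starPotential, ← hℓ.eq_one_add x hx]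

theorem IsRevealTime.exists_abs_starPotential_le {p : ℝ} (hp : 1 / 2 ≤ p) {ℓ : ℝ → ℝ}
    (hℓ : IsRevealTime p ℓ) (v : ℝ) :
    ∃ C, ∀ θ : unitInterval, |starPotential p v ℓ (foldBelief θ)| ≤ C := by
  obtain ⟨C, hC⟩ := hℓ.bounded
  refine ⟨1 + |v| * (1 + C), fun θ => ?_⟩
  have hx := foldBelief_mem_Icc θ
  have hone_sub : |1 - foldBelief θ| ≤ 1 := abs_le.2 ⟨by linarith [hx.2], by linarith [hx.1]⟩
  calc |starPotential p v ℓ (foldBelief θ)|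
      ≤ |1| + |v * (1 + (1 - foldBelief θ) * ℓ (foldMap p (foldBelief θ)))| := abs_sub _ _
    _ = 1 + |v| * |1 + (1 - foldBelief θ) * ℓ (foldMap p (foldBelief θ))| := by
      rw [abs_one, abs_mul]
    _ ≤ 1 + |v| * (|1| + |1 - foldBelief θ| * |ℓ (foldMap p (foldBelief θ))|) := by
      gcongr
      exact (abs_add_le _ _).trans_eq (by rw [abs_mul])
    _ ≤ 1 + |v| * (1 + 1 * C) := by
      rw [abs_one]
      gcongr
      exact hC _ (foldMap_mem_Icc hp hx)
    _ = 1 + |v| * (1 + C) := by rw [one_mul]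

theorem IsRevealTime.beliefDrift_starPotential {p : ℝ} (hp : 1 / 2 ≤ p) {ℓ : ℝ → ℝ}
    (hℓ : IsRevealTime p ℓ) {v : ℝ} (hv : v * ℓ (1 - p) = 1) (E : EqualizingStrategy p)
    {θ : unitInterval} {x g : ℝ} (hx : foldBelief θ = x) (hg : E.stageGain θ = g) :
    E.beliefDrift (fun θ => starPotential p v ℓ (foldBelief θ)) θ =
      v + v * ((1 - x) * (ℓ (foldMap p x) - ℓ (foldStep p (g / (1 - x)))) +
        x * (ℓ (1 - p) - ℓ (foldStep p (g / x)))) - (x - g) := by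
  have hgain := E.stageGain_mem_Icc θ
  have hhalf := foldBelief_le_half θ
  rw [hx, hg] at hgain
  rw [hx] at hhalf
  have hfar : g / (1 - x) ∈ unitInterval :=
    unitInterval.div_mem hgain.1 (by linarith) (by linarith [hgain.2])
  have hnear : g / x ∈ unitInterval :=
    unitInterval.div_mem hgain.1 (hgain.1.trans hgain.2) hgain.2
  rw [E.beliefDrift_foldBelief, hx, hg, hℓ.starPotential_eq (foldStep_mem_Icc hp hfar),
    hℓ.starPotential_eq (foldStep_mem_Icc hp hnear), starPotential]
  linear_combination -x * hv

theorem IsRevealTime.beliefDrift_starPotential_of_eq {p : ℝ} (hp : 1 / 2 ≤ p) {ℓ : ℝ → ℝ}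
    (hℓ : IsRevealTime p ℓ) {v : ℝ} (hv : v * ℓ (1 - p) = 1) (E : EqualizingStrategy p)
    {θ : unitInterval} (hθ : E.stageGain θ = foldBelief θ) :
    E.beliefDrift (fun θ => starPotential p v ℓ (foldBelief θ)) θ = v := by
  rw [E.beliefDrift_of_stageGain_eq hp _ hθ,
    hℓ.starPotential_eq (foldMap_mem_Icc hp (foldBelief_mem_Icc θ)),
    hℓ.starPotential_eq ⟨le_rfl, by linarith⟩, starPotential]
  linear_combination -foldBelief θ * hv

theorem IsRevealTime.guarantees1_sigmaStar_iff {p : unitInterval} (hp : 1 / 2 ≤ (p : ℝ))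
    {ℓ : ℝ → ℝ} (hℓ : IsRevealTime p ℓ) (hne : ℓ (1 - p) ≠ 0) {θ₀ : unitInterval} {v : ℝ} :
    Guarantees1 p θ₀ (sigmaStar p θ₀) v ↔ v ≤ (ℓ (1 - p))⁻¹ := by
  have hdrift θ := hℓ.beliefDrift_starPotential_of_eq hp (inv_mul_cancel₀ hne) (star p) (θ := θ) rfl
  obtain ⟨C, hC⟩ := hℓ.exists_abs_starPotential_le hp (ℓ (1 - p))⁻¹
  rw [sigmaStar_eq_strategy_star]
  exact ⟨(star p).le_of_guarantees1 hC fun θ => (hdrift θ).le,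
    fun hv => (star p).guarantees1 hC (fun θ => hv.trans (hdrift θ).ge) θ₀⟩

theorem RevealCertificate.sigmaStarOptimal {p : unitInterval} (hp : 1 / 2 ≤ (p : ℝ))
    (Z : RevealCertificate p) {ℓ : ℝ → ℝ} (hℓ : IsRevealTime p ℓ) (h0 : Z.u 0 = ℓ (1 - p)) :
    SigmaStarOptimal p := by
  intro θ₀
  have hne : ℓ (1 - p) ≠ 0 := h0 ▸ Z.u_zero_pos.ne'
  have hstar : Guarantees1 p θ₀ (sigmaStar p θ₀) (ℓ (1 - p))⁻¹ :=
    (hℓ.guarantees1_sigmaStar_iff hp hne).2 le_rfl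
  exact ⟨_, ⟨⟨_, hstar⟩, _, h0 ▸ Z.guarantees2 θ₀⟩, hstar⟩

section SmallParameter

variable {p : ℝ}

theorem isRevealTime_of_le_two_thirds (hp : 1 / 2 ≤ p) (hp' : p ≤ 2 / 3) :
    IsRevealTime p fun x => 3 - x / p where
  eq_one_add x hx := by
    have : 1 - x ≠ 0 := by linarith [hx.2]
    have : p ≠ 0 := by linarith
    simp only [foldMap_of_ge hp (show 1 / 3 ≤ x by linarith [hx.1]) (by linarith [hx.2])]
    field_simp
    ring
  bounded := by
    refine ⟨3, fun x hx => ?_⟩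
    have hnonneg : 0 ≤ x / p := div_nonneg (by linarith [hx.1]) (by linarith)
    have hle : x / p ≤ 1 := (div_le_one (by linarith)).2 (by linarith [hx.2])
    exact abs_le.2 ⟨by linarith, by linarith⟩

/-- For `p ≤ 2 / 3` the expected reveal time is affine, so a single affine function suffices. -/
noncomputable def affineCertificate (hp : 1 / 2 ≤ p) (hp' : p ≤ 2 / 3) : RevealCertificate p :=
  have hp0 : 0 < p := by linarith
  have hle : 1 / p ≤ 2 := by
    rw [div_le_iff₀ hp0]
    linarith
  have hge : 1 ≤ 1 / p := by
    rw [le_div_iff₀ hp0]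
    linarith
  { keep := fun _ => false
    u := fun _ => 4 - 1 / p
    w := fun _ => 2
    u_eq := fun _ => by
      simp only [cond_false]
      field_simp
      ring
    w_eq := fun _ => by
      simp only [cond_false]
      field_simp
      ring
    u_zero_pos := by linarith
    u_nonneg := fun _ => by linarith
    w_nonneg := fun _ => zero_le_two
    u_le := fun _ => le_rfl
    w_le := fun _ => by linarith
    abs_sub_le := fun _ => abs_le.2 ⟨by linarith, by linarith⟩ }

theorem sigmaStarOptimal_of_le_two_thirds {p : unitInterval} (hp : 1 / 2 ≤ (p : ℝ))
    (hp' : (p : ℝ) ≤ 2 / 3) : SigmaStarOptimal p := by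
  refine (affineCertificate hp hp').sigmaStarOptimal hp (isRevealTime_of_le_two_thirds hp hp') ?_
  have : (p : ℝ) ≠ 0 := by linarith
  simp only [affineCertificate]
  field_simp
  ring

end SmallParameter

/-! ### Convexity of the reveal time -/

section RevealTime

variable {p s t x : ℝ} {n : ℕ}

/-- Iterates of the recursion for the expected reveal time. The constant they start from makes the
first few of them satisfy `IsFlatIter`. -/
noncomputable def timeIter (p : ℝ) : ℕ → ℝ → ℝ
  | 0, _ => 7 / 10
  | n + 1, x => 1 + (1 - x) * timeIter p n (foldMap p x)

theorem timeIter_mem_Icc (hp : 1 / 2 ≤ p) (hp1 : p < 1) (n : ℕ)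
    (hx : x ∈ Set.Icc (1 - p) (1 / 2)) : timeIter p n x ∈ Set.Icc 0 (1 / (1 - p)) := by
  have hq : 0 < 1 - p := by linarith
  have hone : 1 / (1 - p) * (1 - p) = 1 := div_mul_cancel₀ _ hq.ne'
  have hge : 1 ≤ 1 / (1 - p) := by
    rw [le_div_iff₀ hq]
    linarith
  induction n generalizing x with
  | zero => exact ⟨by norm_num [timeIter], by simp only [timeIter]; linarith⟩
  | succ n ih =>
    obtain ⟨hnonneg, hle⟩ := ih (foldMap_mem_Icc hp ⟨hq.le.trans hx.1, hx.2⟩)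
    exact ⟨by simp only [timeIter]; nlinarith [hx.2], by simp only [timeIter]; nlinarith [hx.1]⟩

theorem abs_timeIter_succ_sub_le (hp : 1 / 2 ≤ p) (hp1 : p < 1) (n : ℕ)
    (hx : x ∈ Set.Icc (1 - p) (1 / 2)) : |timeIter p (n + 1) x - timeIter p n x| ≤ p ^ n := by
  induction n generalizing x with
  | zero =>
    simp only [timeIter, pow_zero, abs_le]
    constructor <;> linarith [hx.1, hx.2]
  | succ n ih =>
    have hdiff : timeIter p (n + 1 + 1) x - timeIter p (n + 1) x =
        (1 - x) * (timeIter p (n + 1) (foldMap p x) - timeIter p n (foldMap p x)) := by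
      simp only [timeIter]
      ring
    rw [hdiff, abs_mul, abs_of_nonneg (by linarith [hx.2]), pow_succ']
    exact mul_le_mul (by linarith [hx.1])
      (ih (foldMap_mem_Icc hp ⟨by linarith [hx.1], hx.2⟩)) (abs_nonneg _) (by linarith)

/-- The expected reveal time at the folded belief `x`. -/
noncomputable def revealTime (p x : ℝ) : ℝ := limUnder atTop fun n => timeIter p n x

theorem tendsto_timeIter (hp : 1 / 2 ≤ p) (hp1 : p < 1) (hx : x ∈ Set.Icc (1 - p) (1 / 2)) :
    Tendsto (fun n => timeIter p n x) atTop (nhds (revealTime p x)) :=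
  tendsto_nhds_limUnder <| cauchySeq_tendsto_of_complete <|
    cauchySeq_of_le_geometric p 1 hp1 fun n => by
      rw [dist_comm, Real.dist_eq, one_mul]
      exact abs_timeIter_succ_sub_le hp hp1 n hx

theorem revealTime_mem_Icc (hp : 1 / 2 ≤ p) (hp1 : p < 1) (hx : x ∈ Set.Icc (1 - p) (1 / 2)) :
    revealTime p x ∈ Set.Icc 0 (1 / (1 - p)) :=
  isClosed_Icc.mem_of_tendsto (tendsto_timeIter hp hp1 hx)
    (Eventually.of_forall fun n => timeIter_mem_Icc hp hp1 n hx)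

theorem isRevealTime_revealTime (hp : 1 / 2 ≤ p) (hp1 : p < 1) :
    IsRevealTime p (revealTime p) where
  eq_one_add x hx := by
    have hfold := foldMap_mem_Icc hp ⟨by linarith [hx.1], hx.2⟩
    exact tendsto_nhds_unique ((tendsto_add_atTop_iff_nat 1).2 (tendsto_timeIter hp hp1 hx))
      (((tendsto_timeIter hp hp1 hfold).const_mul _).const_add 1)
  bounded := ⟨1 / (1 - p), fun x hx => by
    rw [abs_of_nonneg (revealTime_mem_Icc hp hp1 hx).1]
    exact (revealTime_mem_Icc hp hp1 hx).2⟩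

theorem one_le_revealTime (hp : 1 / 2 ≤ p) (hp1 : p < 1) (hx : x ∈ Set.Icc (1 - p) (1 / 2)) :
    1 ≤ revealTime p x := by
  have hfold := foldMap_mem_Icc hp ⟨by linarith [hx.1], hx.2⟩
  rw [(isRevealTime_revealTime hp hp1).eq_one_add x hx, le_add_iff_nonneg_right]
  exact mul_nonneg (by linarith [hx.2]) (revealTime_mem_Icc hp hp1 hfold).1

/-- Whether the non-revealing move of `σ*` at the folded belief `x` keeps the likelier state. -/
noncomputable def keepsOrder (x : ℝ) : Bool := decide (x ≤ 1 / 3)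

theorem keepsOrder_of_le (h : x ≤ 1 / 3) : keepsOrder x = true := decide_eq_true h

theorem keepsOrder_of_gt (h : 1 / 3 < x) : keepsOrder x = false := decide_eq_false h.not_ge

/-- The recursion for minus the derivative of the expected reveal time at `x`, where `l` and `-e`
are the value and the derivative at `foldMap p x`. -/
noncomputable def slopeStep (p x l e : ℝ) : ℝ :=
  l + cond (keepsOrder x) 1 (-1) * ((2 * p - 1) / (1 - x)) * e

/-- The line with value `l` and slope `-e` at `s`, evaluated at `t`. -/
def tangent (l e s t : ℝ) : ℝ := l + (s - t) * e

theorem tangent_step (hp : 1 / 2 ≤ p) (hx : x < 1) (l e t : ℝ) :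
    tangent (1 + (1 - x) * l) (slopeStep p x l e) x t =
      1 + t * cond (keepsOrder x) (tangent l e (foldMap p x) p)
          (tangent l e (foldMap p x) (1 - p)) +
        (1 - 2 * t) * cond (keepsOrder x) (tangent l e (foldMap p x) (1 - p))
          (tangent l e (foldMap p x) p) := by
  have : 1 - x ≠ 0 := by linarith
  rcases le_or_gt x (1 / 3) with h | h
  · simp only [slopeStep, keepsOrder_of_le h, cond_true, foldMap_of_le hp h, tangent]
    field_simp
    ring
  · simp only [slopeStep, keepsOrder_of_gt h, cond_false, foldMap_of_ge hp h.le hx, tangent]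
    field_simp
    ring

theorem slopeStep_eq (hp : 1 / 2 ≤ p) (hx : x < 1) (l e : ℝ) :
    slopeStep p x l e =
      2 * cond (keepsOrder x) (tangent l e (foldMap p x) (1 - p)) (tangent l e (foldMap p x) p) -
        cond (keepsOrder x) (tangent l e (foldMap p x) p) (tangent l e (foldMap p x) (1 - p)) := by
  have hzero := tangent_step hp hx l e 0
  have hone := tangent_step hp hx l e 1
  simp only [tangent] at hzero hone ⊢
  linarith

/-- Minus the derivative of `timeIter`. -/
noncomputable def slopeIter (p : ℝ) : ℕ → ℝ → ℝ
  | 0, _ => 0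
  | n + 1, x => slopeStep p x (timeIter p n (foldMap p x)) (slopeIter p n (foldMap p x))

/-- The tangent to the `n`-th iterate at `s`, evaluated at `t`. -/
noncomputable def tangentIter (p : ℝ) (n : ℕ) (s t : ℝ) : ℝ :=
  tangent (timeIter p n s) (slopeIter p n s) s t

theorem tangentIter_zero (p s t : ℝ) : tangentIter p 0 s t = 7 / 10 := by
  simp [tangentIter, tangent, timeIter, slopeIter]

theorem tangentIter_self (p : ℝ) (n : ℕ) (s : ℝ) : tangentIter p n s s = timeIter p n s := by
  simp [tangentIter, tangent]

theorem tangentIter_succ (hp : 1 / 2 ≤ p) (hx : x < 1) (n : ℕ) (t : ℝ) :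
    tangentIter p (n + 1) x t =
      1 + t * cond (keepsOrder x) (tangentIter p n (foldMap p x) p)
          (tangentIter p n (foldMap p x) (1 - p)) +
        (1 - 2 * t) * cond (keepsOrder x) (tangentIter p n (foldMap p x) (1 - p))
          (tangentIter p n (foldMap p x) p) :=
  tangent_step hp hx _ _ t

theorem exists_tangentIter_succ_eq (hp : 1 / 2 ≤ p) (n : ℕ) (hx : x < 1)
    (ht : t ∈ Set.Icc (0 : ℝ) (1 / 2)) :
    ∃ y ∈ Set.Icc (1 - p) p, foldBelief y = foldMap p t ∧
      tangentIter p (n + 1) x t = 1 + (1 - t) * tangentIter p n (foldMap p x) y := by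
  have : 1 - t ≠ 0 := by linarith [ht.2]
  obtain ⟨h0, h1⟩ := div_one_sub_mem_unitInterval ht
  rw [tangentIter_succ hp hx]
  unfold tangentIter tangent
  cases keepsOrder x
  · refine ⟨1 - (1 - p + (2 * p - 1) * (t / (1 - t))), ⟨by nlinarith, by nlinarith⟩,
      foldBelief_one_sub _, ?_⟩
    simp only [cond_false]
    field_simp
    ring
  · refine ⟨1 - p + (2 * p - 1) * (t / (1 - t)), ⟨by nlinarith, by nlinarith⟩, rfl, ?_⟩
    simp only [cond_true]
    field_simp
    ring

/-- The tangents to the `n`-th iterate stay below it, also after extending the iterate evenly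
around `1 / 2`. -/
def IsConvexIter (p : ℝ) (n : ℕ) : Prop :=
  ∀ s ∈ Set.Icc (1 - p) (1 / 2), ∀ t ∈ Set.Icc (1 - p) p,
    tangentIter p n s t ≤ timeIter p n (foldBelief t)

/-- The `n`-th iterate is decreasing, but not too fast. -/
def IsFlatIter (p : ℝ) (n : ℕ) : Prop :=
  ∀ s ∈ Set.Icc (1 - p) (1 / 2), 0 ≤ slopeIter p n s ∧
    tangentIter p n s (1 - p) ≤ 2 * tangentIter p n s p

theorem tangentIter_anti (he : 0 ≤ slopeIter p n s) {t t' : ℝ} (h : t ≤ t') :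
    tangentIter p n s t' ≤ tangentIter p n s t := by
  unfold tangentIter tangent
  gcongr

theorem IsFlatIter.slopeIter_succ_nonneg (hp : 1 / 2 ≤ p) (hp1 : p ≤ 1) (hf : IsFlatIter p n)
    (hs : s ∈ Set.Icc (1 - p) (1 / 2)) : 0 ≤ slopeIter p (n + 1) s := by
  obtain ⟨he, hle⟩ := hf _ (foldMap_mem_Icc hp ⟨by linarith [hs.1], hs.2⟩)
  have hanti := tangentIter_anti he (show 1 - p ≤ p by linarith)
  rw [slopeIter, slopeStep_eq hp (by linarith [hs.2])]
  unfold tangentIter at hanti hle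
  cases keepsOrder s
  · simp only [cond_false]
    linarith
  · simp only [cond_true]
    linarith

theorem IsConvexIter.succ (hp : 1 / 2 ≤ p) (hp1 : p ≤ 1) (hc : IsConvexIter p n)
    (hf : IsFlatIter p n) : IsConvexIter p (n + 1) := by
  intro s hs t ht
  have he := hf.slopeIter_succ_nonneg hp hp1 hs
  have hfold : foldBelief t ∈ Set.Icc (0 : ℝ) (1 / 2) :=
    foldBelief_mem_Icc ⟨t, by linarith [ht.1], by linarith [ht.2]⟩
  obtain ⟨y, hy, hyt, heq⟩ := exists_tangentIter_succ_eq hp n (by linarith [hs.2] : s < 1) hfold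
  calc tangentIter p (n + 1) s t
      ≤ tangentIter p (n + 1) s (foldBelief t) := tangentIter_anti he (min_le_left _ _)
    _ = 1 + (1 - foldBelief t) * tangentIter p n (foldMap p s) y := heq
    _ ≤ 1 + (1 - foldBelief t) * timeIter p n (foldBelief y) := by
      gcongr
      · linarith [hfold.2]
      · exact hc _ (foldMap_mem_Icc hp ⟨by linarith [hs.1], hs.2⟩) _ hy
    _ = timeIter p (n + 1) (foldBelief t) := by rw [hyt, timeIter]

theorem IsConvexIter.le_timeIter (hp : 1 / 2 ≤ p) (hc : IsConvexIter p n)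
    (hs : s ∈ Set.Icc (1 - p) (1 / 2)) (ht : t ∈ Set.Icc (1 - p) (1 / 2)) :
    tangentIter p n s t ≤ timeIter p n t := by
  simpa only [foldBelief_of_le ht.2] using hc s hs t ⟨ht.1, by linarith [ht.2]⟩

theorem IsConvexIter.tangentIter_right_le (hp : 1 / 2 ≤ p) (hc : IsConvexIter p n)
    (hs : s ∈ Set.Icc (1 - p) (1 / 2)) : tangentIter p n (1 - p) p ≤ tangentIter p n s p := by
  have hq : 1 - p ∈ Set.Icc (1 - p) (1 / 2) := ⟨le_rfl, by linarith⟩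
  rcases hs.1.eq_or_lt with rfl | h
  · rfl
  have hle := hc.le_timeIter hp hq hs
  have hge := hc.le_timeIter hp hs hq
  unfold tangentIter tangent at *
  have hslope : slopeIter p n s ≤ slopeIter p n (1 - p) :=
    le_of_mul_le_mul_left (by linarith) (sub_pos.2 h)
  have := mul_le_mul_of_nonneg_left hslope (show 0 ≤ p - s by linarith [hs.2])
  linarith

theorem IsConvexIter.isFlatIter (hp : 1 / 2 ≤ p) (hc : IsConvexIter p n)
    (hslope : ∀ s ∈ Set.Icc (1 - p) (1 / 2), 0 ≤ slopeIter p n s)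
    (hstart : tangentIter p n (1 - p) (1 - p) ≤ 2 * tangentIter p n (1 - p) p) :
    IsFlatIter p n := by
  intro s hs
  have hq : 1 - p ∈ Set.Icc (1 - p) (1 / 2) := ⟨le_rfl, by linarith⟩
  refine ⟨hslope s hs, ?_⟩
  calc tangentIter p n s (1 - p) ≤ timeIter p n (1 - p) := hc.le_timeIter hp hs hq
    _ = tangentIter p n (1 - p) (1 - p) := (tangentIter_self _ _ _).symm
    _ ≤ 2 * tangentIter p n (1 - p) p := hstart
    _ ≤ 2 * tangentIter p n s p := by linarith [hc.tangentIter_right_le hp hs]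

end RevealTime

section Orbit

variable {p x X Y : ℝ}

/-- The belief `x` gives the two states weights proportional to `X` and `Y`. -/
structure HasOdds (x X Y : ℝ) : Prop where
  add_pos : 0 < X + Y
  eq_div : x = X / (X + Y)

namespace HasOdds

theorem mul_add_eq (h : HasOdds x X Y) : x * (X + Y) = X := by
  rw [h.eq_div, div_mul_cancel₀ _ h.add_pos.ne']

theorem snd_pos (h : HasOdds x X Y) (hx : x < 1) : 0 < Y := by
  have := mul_pos (sub_pos.2 hx) h.add_pos
  linarith [h.mul_add_eq]

theorem div_one_sub (h : HasOdds x X Y) (hx : x < 1) : x / (1 - x) = X / Y := by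
  rw [div_eq_div_iff (by linarith) (h.snd_pos hx).ne']
  linear_combination h.mul_add_eq

theorem le_third (h : HasOdds x X Y) (hXY : 2 * X ≤ Y) : x ≤ 1 / 3 := by
  rw [h.eq_div, div_le_iff₀ h.add_pos]
  linarith

theorem third_le (h : HasOdds x X Y) (hXY : Y ≤ 2 * X) : 1 / 3 ≤ x := by
  rw [h.eq_div, le_div_iff₀ h.add_pos]
  linarith

theorem third_lt (h : HasOdds x X Y) (hXY : Y < 2 * X) : 1 / 3 < x := by
  rw [h.eq_div, lt_div_iff₀ h.add_pos]
  linarith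

theorem foldMap_of_le (hp : 1 / 2 ≤ p) (h : HasOdds x X Y) (hx : x < 1) (hXY : 2 * X ≤ Y) :
    HasOdds (foldMap p x) ((2 * p - 1) * X + (1 - p) * Y) (p * Y - (2 * p - 1) * X) := by
  have hY := h.snd_pos hx
  have hsum : (2 * p - 1) * X + (1 - p) * Y + (p * Y - (2 * p - 1) * X) = Y := by ring
  refine ⟨hY.trans_eq hsum.symm, ?_⟩
  rw [RenaultGame.foldMap_of_le hp (h.le_third hXY), h.div_one_sub hx, hsum]
  field_simp
  ring

theorem foldMap_of_ge (hp : 1 / 2 ≤ p) (h : HasOdds x X Y) (hx : x < 1) (hXY : Y ≤ 2 * X) :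
    HasOdds (foldMap p x) (p * Y - (2 * p - 1) * X) ((2 * p - 1) * X + (1 - p) * Y) := by
  have hY := h.snd_pos hx
  have hsum : p * Y - (2 * p - 1) * X + ((2 * p - 1) * X + (1 - p) * Y) = Y := by ring
  refine ⟨hY.trans_eq hsum.symm, ?_⟩
  rw [RenaultGame.foldMap_of_ge hp (h.third_le hXY) hx, h.div_one_sub hx, hsum]
  field_simp

end HasOdds

/-- The folded beliefs after a revealing move, as long as no further move is revealing. -/
noncomputable def orbit (p : ℝ) (k : ℕ) : ℝ := (foldMap p)^[k] (1 - p)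

theorem orbit_zero (p : ℝ) : orbit p 0 = 1 - p := rfl

theorem orbit_succ (p : ℝ) (k : ℕ) : orbit p (k + 1) = foldMap p (orbit p k) :=
  Function.iterate_succ_apply' _ _ _

theorem orbit_mem_Icc (hp : 1 / 2 ≤ p) (hp1 : p ≤ 1) (k : ℕ) :
    orbit p k ∈ Set.Icc (1 - p) (1 / 2) := by
  induction k with
  | zero => exact ⟨le_rfl, by rw [orbit_zero]; linarith⟩
  | succ k ih =>
    rw [orbit_succ]
    exact foldMap_mem_Icc hp ⟨by linarith [ih.1], ih.2⟩

end Orbit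

section MediumParameter

variable {p s : ℝ} {n : ℕ}

theorem pow_succ_le_mul_pow (hs : 0 ≤ s) (hs' : s ≤ 21 / 400) (k : ℕ) :
    s ^ (k + 1) ≤ 21 / 400 * s ^ k := by
  rw [pow_succ']
  gcongr

theorem keepsOrder_orbit_and_hasOdds (hs : 0 < s) (hs' : s ≤ 21 / 400) :
    keepsOrder (orbit (2 / 3 + s) 0) = true ∧ keepsOrder (orbit (2 / 3 + s) 1) = false ∧
      keepsOrder (orbit (2 / 3 + s) 2) = false ∧
      HasOdds (orbit (2 / 3 + s) 3) (1 / 9 + s / 3 - 2 * s ^ 2 - 18 * s ^ 3 - 27 * s ^ 4)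
        (1 / 9 + s / 3 + s ^ 2 + 9 * s ^ 3 + 27 * s ^ 4) := by
  have hp : 1 / 2 ≤ 2 / 3 + s := by linarith
  have hlt (k : ℕ) : orbit (2 / 3 + s) k < 1 := by
    linarith [(orbit_mem_Icc hp (by linarith) k).2]
  have hpow (k : ℕ) : 0 < s ^ k := pow_pos hs k
  have odds0 : HasOdds (orbit (2 / 3 + s) 0) (1 / 3 - s) (2 / 3 + s) :=
    ⟨by linarith, by rw [orbit_zero]; ring⟩
  have order0 : 2 * (1 / 3 - s) ≤ 2 / 3 + s := by linarith
  have odds1 : HasOdds (orbit (2 / 3 + s) 1) (1 / 3 - 3 * s ^ 2) (1 / 3 + s + 3 * s ^ 2) := by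
    rw [orbit_succ]
    convert odds0.foldMap_of_le hp (hlt 0) order0 using 1 <;> ring
  have order1 : 1 / 3 + s + 3 * s ^ 2 < 2 * (1 / 3 - 3 * s ^ 2) := by
    linarith [pow_succ_le_mul_pow hs.le hs' 1]
  have odds2 : HasOdds (orbit (2 / 3 + s) 2) (1 / 9 + s / 3 + 4 * s ^ 2 + 9 * s ^ 3)
      (2 / 9 + 2 / 3 * s - s ^ 2 - 9 * s ^ 3) := by
    rw [orbit_succ]
    convert odds1.foldMap_of_ge hp (hlt 1) order1.le using 1 <;> ring
  have order2 : 2 / 9 + 2 / 3 * s - s ^ 2 - 9 * s ^ 3 <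
      2 * (1 / 9 + s / 3 + 4 * s ^ 2 + 9 * s ^ 3) := by linarith [hpow 2, hpow 3]
  refine ⟨keepsOrder_of_le (odds0.le_third order0), keepsOrder_of_gt (odds1.third_lt order1),
    keepsOrder_of_gt (odds2.third_lt order2), ?_⟩
  rw [orbit_succ]
  convert odds2.foldMap_of_ge hp (hlt 2) order2.le using 1 <;> ring

theorem keepsOrder_orbit (hs : 0 < s) (hs' : s ≤ 21 / 400) :
    keepsOrder (orbit (2 / 3 + s) 0) = true ∧ keepsOrder (orbit (2 / 3 + s) 1) = false ∧
      keepsOrder (orbit (2 / 3 + s) 2) = false ∧ keepsOrder (orbit (2 / 3 + s) 3) = false ∧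
      keepsOrder (orbit (2 / 3 + s) 4) = true ∧ keepsOrder (orbit (2 / 3 + s) 5) = false := by
  have hp : 1 / 2 ≤ 2 / 3 + s := by linarith
  have hlt (k : ℕ) : orbit (2 / 3 + s) k < 1 := by
    linarith [(orbit_mem_Icc hp (by linarith) k).2]
  have hpow (k : ℕ) : 0 < s ^ k := pow_pos hs k
  have hle := pow_succ_le_mul_pow hs.le hs'
  obtain ⟨h0, h1, h2, odds3⟩ := keepsOrder_orbit_and_hasOdds hs hs'
  have order3 : 1 / 9 + s / 3 + s ^ 2 + 9 * s ^ 3 + 27 * s ^ 4 <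
      2 * (1 / 9 + s / 3 - 2 * s ^ 2 - 18 * s ^ 3 - 27 * s ^ 4) := by
    linarith [hle 1, hle 2, hle 3]
  have odds4 : HasOdds (orbit (2 / 3 + s) 4)
      (1 / 27 + s ^ 2 + 17 * s ^ 3 + 72 * s ^ 4 + 81 * s ^ 5)
      (2 / 27 + s / 3 - 8 * s ^ 3 - 45 * s ^ 4 - 81 * s ^ 5) := by
    rw [orbit_succ]
    convert odds3.foldMap_of_ge hp (hlt 3) order3.le using 1 <;> ring
  have order4 : 2 * (1 / 27 + s ^ 2 + 17 * s ^ 3 + 72 * s ^ 4 + 81 * s ^ 5) ≤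
      2 / 27 + s / 3 - 8 * s ^ 3 - 45 * s ^ 4 - 81 * s ^ 5 := by
    linarith [hle 1, hle 2, hle 3, hle 4]
  have odds5 : HasOdds (orbit (2 / 3 + s) 5)
      (1 / 27 + s / 9 + 5 * s ^ 3 + 51 * s ^ 4 + 189 * s ^ 5 + 243 * s ^ 6)
      (1 / 27 + 2 / 9 * s - 13 * s ^ 3 - 96 * s ^ 4 - 270 * s ^ 5 - 243 * s ^ 6) := by
    rw [orbit_succ]
    convert odds4.foldMap_of_le hp (hlt 4) order4 using 1 <;> ring
  have order5 : 1 / 27 + 2 / 9 * s - 13 * s ^ 3 - 96 * s ^ 4 - 270 * s ^ 5 - 243 * s ^ 6 <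
      2 * (1 / 27 + s / 9 + 5 * s ^ 3 + 51 * s ^ 4 + 189 * s ^ 5 + 243 * s ^ 6) := by
    linarith [hpow 3, hpow 4, hpow 5, hpow 6]
  exact ⟨h0, h1, h2, keepsOrder_of_gt (odds3.third_lt order3),
    keepsOrder_of_le (odds4.le_third order4), keepsOrder_of_gt (odds5.third_lt order5)⟩

theorem tangentIter_orbit_succ (hp : 1 / 2 ≤ p) (hp1 : p ≤ 1) (n k : ℕ) (t : ℝ) :
    tangentIter p (n + 1) (orbit p k) t =
      1 + t * cond (keepsOrder (orbit p k)) (tangentIter p n (orbit p (k + 1)) p)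
          (tangentIter p n (orbit p (k + 1)) (1 - p)) +
        (1 - 2 * t) * cond (keepsOrder (orbit p k)) (tangentIter p n (orbit p (k + 1)) (1 - p))
          (tangentIter p n (orbit p (k + 1)) p) := by
  rw [orbit_succ]
  exact tangentIter_succ hp (by linarith [(orbit_mem_Icc hp hp1 k).2]) n t

theorem tangentIter_start_of_lt_six (hs : 0 < s) (hs' : s ≤ 21 / 400) (hn : n < 6) :
    tangentIter (2 / 3 + s) n (orbit (2 / 3 + s) 0) (1 - (2 / 3 + s)) ≤
      2 * tangentIter (2 / 3 + s) n (orbit (2 / 3 + s) 0) (2 / 3 + s) := by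
  have hstep := tangentIter_orbit_succ (p := 2 / 3 + s) (by linarith) (by linarith)
  obtain ⟨h0, h1, h2, h3, h4, -⟩ := keepsOrder_orbit hs hs'
  have hpow (k : ℕ) : 0 < s ^ k := pow_pos hs k
  have hle := pow_succ_le_mul_pow hs.le hs'
  rw [← sub_nonneg]
  interval_cases n <;>
    simp only [hstep _ 0, hstep _ 1, hstep _ 2, hstep _ 3, hstep _ 4, zero_add, Nat.reduceAdd,
      h0, h1, h2, h3, h4, cond_true, cond_false, tangentIter_zero]
  · norm_num
  · exact le_of_le_of_eq (show 0 ≤ 1 - 21 / 10 * s by linarith) (by ring)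
  · exact le_of_le_of_eq (show 0 ≤ 23 / 30 - 13 / 2 * s - 63 / 10 * s ^ 2 by
      linarith [hle 1]) (by ring)
  · exact le_of_le_of_eq (show 0 ≤ 2 / 3 - 8 * s - 27 / 10 * s ^ 2 + 189 / 10 * s ^ 3 by
      linarith [hle 1, hpow 3]) (by ring)
  · exact le_of_le_of_eq (show 0 ≤ 53 / 90 - 289 / 30 * s - 91 / 10 * s ^ 2 - 9 / 2 * s ^ 3 -
      567 / 10 * s ^ 4 by linarith [hle 1, hle 2, hle 3]) (by ring)
  · exact le_of_le_of_eq (show 0 ≤ 5 / 9 - 101 / 10 * s - 6 * s ^ 2 + 141 / 5 * s ^ 3 +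
      513 / 10 * s ^ 4 + 1701 / 10 * s ^ 5 by linarith [hle 1, hpow 3, hpow 4, hpow 5]) (by ring)

theorem IsFlatIter.tangentIter_start_add_six (hs : 0 < s) (hs' : s ≤ 21 / 400)
    (hf : IsFlatIter (2 / 3 + s) n) :
    tangentIter (2 / 3 + s) (n + 6) (orbit (2 / 3 + s) 0) (1 - (2 / 3 + s)) ≤
      2 * tangentIter (2 / 3 + s) (n + 6) (orbit (2 / 3 + s) 0) (2 / 3 + s) := by
  have hp : 1 / 2 ≤ 2 / 3 + s := by linarith
  have hstep := tangentIter_orbit_succ hp (by linarith)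
  obtain ⟨h0, h1, h2, h3, h4, h5⟩ := keepsOrder_orbit hs hs'
  obtain ⟨he, hle⟩ := hf _ (orbit_mem_Icc hp (by linarith) 6)
  have hanti := tangentIter_anti he (show 1 - (2 / 3 + s) ≤ 2 / 3 + s by linarith)
  have hpow (k : ℕ) : 0 < s ^ k := pow_pos hs k
  have hpowle := pow_succ_le_mul_pow hs.le hs'
  rw [← sub_nonneg]
  simp only [hstep _ 0, hstep _ 1, hstep _ 2, hstep _ 3, hstep _ 4, hstep _ 5, zero_add,
    Nat.reduceAdd, h0, h1, h2, h3, h4, h5, cond_true, cond_false]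
  generalize tangentIter (2 / 3 + s) n (orbit (2 / 3 + s) 6) (2 / 3 + s) = w at *
  generalize tangentIter (2 / 3 + s) n (orbit (2 / 3 + s) 6) (1 - (2 / 3 + s)) = u at *
  have hconst : 0 ≤ 5 / 9 - 10 * s - 3 * s ^ 2 + 48 * s ^ 3 + 108 * s ^ 4 + 243 * s ^ 5 := by
    linarith [hpowle 1, hpow 3, hpow 4, hpow 5]
  have hflat : 0 ≤ (1 / 27 + s + 10 * s ^ 2 + 71 * s ^ 3 + 315 * s ^ 4 + 729 * s ^ 5 +
      729 * s ^ 6) * (2 * w - u) := mul_nonneg (by positivity) (by linarith)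
  have hright : 0 ≤ (s / 3 + 10 * s ^ 2 + 66 * s ^ 3 + 189 * s ^ 4 + 243 * s ^ 5) * w :=
    mul_nonneg (by positivity) (by linarith)
  exact (add_nonneg (add_nonneg hconst hflat) hright).trans_eq (by ring)

theorem isConvexIter_and_isFlatIter (h : 2 / 3 < p) (h' : p ≤ 0.7191) (n : ℕ) :
    IsConvexIter p n ∧ IsFlatIter p n := by
  obtain ⟨s, rfl⟩ : ∃ s, p = 2 / 3 + s := ⟨p - 2 / 3, by ring⟩
  have hs : 0 < s := by linarith
  have hs' : s ≤ 21 / 400 := by linarith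
  induction n using Nat.strong_induction_on with
  | _ n ih =>
    have hstart : tangentIter (2 / 3 + s) n (1 - (2 / 3 + s)) (1 - (2 / 3 + s)) ≤
        2 * tangentIter (2 / 3 + s) n (1 - (2 / 3 + s)) (2 / 3 + s) := by
      rcases lt_or_ge n 6 with hn | hn
      · exact tangentIter_start_of_lt_six hs hs' hn
      · obtain ⟨m, rfl⟩ := Nat.exists_eq_add_of_le' hn
        exact (ih m (by omega)).2.tangentIter_start_add_six hs hs'
    rcases n with _ | n
    · refine ⟨fun r _ t _ => ?_, fun r _ => ⟨le_rfl, ?_⟩⟩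
      · rw [tangentIter_zero, timeIter]
      · norm_num [tangentIter_zero]
    · obtain ⟨hc, hf⟩ := ih n (by omega)
      have hc' := hc.succ (by linarith) (by linarith) hf
      exact ⟨hc', hc'.isFlatIter (by linarith)
        (fun r hr => hf.slopeIter_succ_nonneg (by linarith) (by linarith) hr) hstart⟩

end MediumParameter

/-! ### Tangents to the reveal time -/

section RevealSlope

variable {p x t : ℝ}

theorem abs_slopeStep_sub_le (hp : 1 / 2 ≤ p) (hx : x ≤ 1 / 2) (l l' e e' : ℝ) :
    |slopeStep p x l e - slopeStep p x l' e'| ≤ |l - l'| + 2 * (2 * p - 1) * |e - e'| := by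
  have hdiff : slopeStep p x l e - slopeStep p x l' e' =
      l - l' + cond (keepsOrder x) 1 (-1) * ((2 * p - 1) / (1 - x)) * (e - e') := by
    unfold slopeStep
    ring
  have hsign : |(cond (keepsOrder x) 1 (-1) : ℝ)| = 1 := by
    cases keepsOrder x <;> simp only [cond_true, cond_false, abs_neg, abs_one]
  have hcoeff : |(2 * p - 1) / (1 - x)| ≤ 2 * (2 * p - 1) := by
    rw [abs_of_nonneg (div_nonneg (by linarith) (by linarith)), div_le_iff₀ (by linarith)]
    nlinarith
  rw [hdiff]
  refine (abs_add_le _ _).trans ?_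
  rw [abs_mul, abs_mul, hsign, one_mul]
  gcongr

theorem abs_slopeIter_succ_sub_le (hp : 1 / 2 ≤ p) (hp1 : p < 3 / 4) (n : ℕ)
    (hx : x ∈ Set.Icc (1 - p) (1 / 2)) :
    |slopeIter p (n + 1) x - slopeIter p n x| ≤ (3 / 2 - 2 * p)⁻¹ * (2 * p - 1 / 2) ^ n := by
  have hgap : 0 < 3 / 2 - 2 * p := by linarith
  induction n generalizing x with
  | zero =>
    have htwo : 2 ≤ (3 / 2 - 2 * p)⁻¹ := by
      rw [le_inv_comm₀ two_pos hgap]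
      linarith
    simp only [slopeIter, slopeStep, timeIter, mul_zero, add_zero, sub_zero, pow_zero, mul_one]
    rw [abs_of_pos (by norm_num)]
    linarith
  | succ n ih =>
    have hfold := foldMap_mem_Icc hp ⟨by linarith [hx.1], hx.2⟩
    calc |slopeIter p (n + 1 + 1) x - slopeIter p (n + 1) x|
        ≤ |timeIter p (n + 1) (foldMap p x) - timeIter p n (foldMap p x)| +
            2 * (2 * p - 1) * |slopeIter p (n + 1) (foldMap p x) - slopeIter p n (foldMap p x)| :=
          abs_slopeStep_sub_le hp hx.2 _ _ _ _
      _ ≤ (2 * p - 1 / 2) ^ n +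
            2 * (2 * p - 1) * ((3 / 2 - 2 * p)⁻¹ * (2 * p - 1 / 2) ^ n) := by
          gcongr
          · exact (abs_timeIter_succ_sub_le hp (by linarith) n hfold).trans
              (pow_le_pow_left₀ (by linarith) (by linarith) n)
          · linarith
          · exact ih hfold
      _ = (3 / 2 - 2 * p)⁻¹ * (2 * p - 1 / 2) ^ (n + 1) := by
          rw [pow_succ]
          linear_combination -(2 * p - 1 / 2) ^ n * inv_mul_cancel₀ hgap.ne'

/-- Minus the derivative of the expected reveal time at the folded belief `x`. -/
noncomputable def revealSlope (p x : ℝ) : ℝ := limUnder atTop fun n => slopeIter p n x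

theorem tendsto_slopeIter (hp : 1 / 2 ≤ p) (hp1 : p < 3 / 4) (hx : x ∈ Set.Icc (1 - p) (1 / 2)) :
    Tendsto (fun n => slopeIter p n x) atTop (nhds (revealSlope p x)) :=
  tendsto_nhds_limUnder <| cauchySeq_tendsto_of_complete <|
    cauchySeq_of_le_geometric (2 * p - 1 / 2) (3 / 2 - 2 * p)⁻¹ (by linarith) fun n => by
      rw [dist_comm, Real.dist_eq]
      exact abs_slopeIter_succ_sub_le hp hp1 n hx

theorem revealSlope_eq (hp : 1 / 2 ≤ p) (hp1 : p < 3 / 4) (hx : x ∈ Set.Icc (1 - p) (1 / 2)) :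
    revealSlope p x = slopeStep p x (revealTime p (foldMap p x)) (revealSlope p (foldMap p x)) := by
  have hfold := foldMap_mem_Icc hp ⟨by linarith [hx.1], hx.2⟩
  exact tendsto_nhds_unique ((tendsto_add_atTop_iff_nat 1).2 (tendsto_slopeIter hp hp1 hx))
    ((tendsto_timeIter hp (by linarith) hfold).add
      ((tendsto_slopeIter hp hp1 hfold).const_mul _))

/-- The tangent to the expected reveal time at the `k`-th point of the orbit, evaluated at `t`. -/
noncomputable def orbitTangent (p : ℝ) (k : ℕ) (t : ℝ) : ℝ :=
  tangent (revealTime p (orbit p k)) (revealSlope p (orbit p k)) (orbit p k) t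

theorem orbitTangent_zero (p : ℝ) : orbitTangent p 0 (1 - p) = revealTime p (1 - p) := by
  simp [orbitTangent, tangent, orbit_zero]

theorem tendsto_tangentIter_orbit (hp : 1 / 2 ≤ p) (hp1 : p < 3 / 4) (k : ℕ) (t : ℝ) :
    Tendsto (fun n => tangentIter p n (orbit p k) t) atTop (nhds (orbitTangent p k t)) := by
  have hk := orbit_mem_Icc hp (by linarith) k
  exact (tendsto_timeIter hp (by linarith) hk).add ((tendsto_slopeIter hp hp1 hk).const_mul _)

theorem orbitTangent_eq (hp : 1 / 2 ≤ p) (hp1 : p < 3 / 4) (k : ℕ) (t : ℝ) :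
    orbitTangent p k t =
      1 + t * cond (keepsOrder (orbit p k)) (orbitTangent p (k + 1) p)
          (orbitTangent p (k + 1) (1 - p)) +
        (1 - 2 * t) * cond (keepsOrder (orbit p k)) (orbitTangent p (k + 1) (1 - p))
          (orbitTangent p (k + 1) p) := by
  have hk := orbit_mem_Icc hp (by linarith) k
  simp only [orbitTangent, orbit_succ]
  rw [← tangent_step hp (by linarith [hk.2]), revealSlope_eq hp hp1 hk,
    (isRevealTime_revealTime hp (by linarith)).eq_one_add _ hk]

end RevealSlope

section MediumCertificate

variable {p : ℝ}

theorem orbitTangent_le_zero (h : 2 / 3 < p) (h' : p ≤ 0.7191) (k : ℕ) :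
    orbitTangent p k (1 - p) ≤ orbitTangent p 0 (1 - p) := by
  have hp : 1 / 2 ≤ p := by linarith
  refine le_of_tendsto_of_tendsto' (tendsto_tangentIter_orbit hp (by linarith) k _)
    (tendsto_tangentIter_orbit hp (by linarith) 0 _) fun n => ?_
  rw [orbit_zero, tangentIter_self]
  exact (isConvexIter_and_isFlatIter h h' n).1.le_timeIter hp
    (orbit_mem_Icc hp (by linarith) k) ⟨le_rfl, by linarith⟩

theorem orbitTangent_zero_le (h : 2 / 3 < p) (h' : p ≤ 0.7191) (k : ℕ) :
    orbitTangent p 0 p ≤ orbitTangent p k p := by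
  have hp : 1 / 2 ≤ p := by linarith
  exact le_of_tendsto_of_tendsto' (tendsto_tangentIter_orbit hp (by linarith) 0 _)
    (tendsto_tangentIter_orbit hp (by linarith) k _) fun n =>
      (isConvexIter_and_isFlatIter h h' n).1.tangentIter_right_le hp
        (orbit_mem_Icc hp (by linarith) k)

theorem orbitTangent_anti (h : 2 / 3 < p) (h' : p ≤ 0.7191) (k : ℕ) :
    orbitTangent p k p ≤ orbitTangent p k (1 - p) := by
  have hp : 1 / 2 ≤ p := by linarith
  exact le_of_tendsto_of_tendsto' (tendsto_tangentIter_orbit hp (by linarith) k _)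
    (tendsto_tangentIter_orbit hp (by linarith) k _) fun n =>
      tangentIter_anti ((isConvexIter_and_isFlatIter h h' n).2 _
        (orbit_mem_Icc hp (by linarith) k)).1 (by linarith)

theorem orbitTangent_le_two_mul (h : 2 / 3 < p) (h' : p ≤ 0.7191) (k : ℕ) :
    orbitTangent p k (1 - p) ≤ 2 * orbitTangent p k p := by
  have hp : 1 / 2 ≤ p := by linarith
  exact le_of_tendsto_of_tendsto' (tendsto_tangentIter_orbit hp (by linarith) k _)
    ((tendsto_tangentIter_orbit hp (by linarith) k _).const_mul 2) fun n =>
      ((isConvexIter_and_isFlatIter h h' n).2 _ (orbit_mem_Icc hp (by linarith) k)).2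

/-- The certificate whose continuation values are read off the tangents along the orbit. -/
noncomputable def tangentCertificate (h : 2 / 3 < p) (h' : p ≤ 0.7191) : RevealCertificate p where
  keep k := keepsOrder (orbit p k)
  u k := orbitTangent p k (1 - p)
  w k := orbitTangent p k p
  u_eq k := by
    rw [orbitTangent_eq (by linarith) (by linarith)]
    ring
  w_eq k := by
    rw [orbitTangent_eq (by linarith) (by linarith)]
    ring
  u_zero_pos := by
    rw [orbitTangent_zero]
    exact zero_lt_one.trans_le
      (one_le_revealTime (by linarith) (by linarith) ⟨le_rfl, by linarith⟩)
  u_nonneg k := by linarith [orbitTangent_anti h h' k, orbitTangent_le_two_mul h h' k]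
  w_nonneg k := by linarith [orbitTangent_anti h h' k, orbitTangent_le_two_mul h h' k]
  u_le := orbitTangent_le_zero h h'
  w_le k := (orbitTangent_anti h h' k).trans (orbitTangent_le_zero h h' k)
  abs_sub_le k := by
    rw [abs_of_nonneg (sub_nonneg.2 (orbitTangent_anti h h' k))]
    linarith [orbitTangent_le_zero h h' k, orbitTangent_zero_le h h' k,
      orbitTangent_le_two_mul h h' 0]

theorem sigmaStarOptimal_of_two_thirds_lt {p : unitInterval} (h : 2 / 3 < (p : ℝ))
    (h' : (p : ℝ) ≤ 0.7191) : SigmaStarOptimal p :=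
  (tangentCertificate h h').sigmaStarOptimal (by linarith)
    (isRevealTime_revealTime (by linarith) (by linarith)) (orbitTangent_zero _)

end MediumCertificate

/-! ### The reveal time at the bad parameter -/

section Lipschitz

variable {p Λ x y : ℝ} {z w : ℝ × ℝ}

theorem abs_foldBelief_sub_le (x y : ℝ) : |foldBelief x - foldBelief y| ≤ |x - y| := by
  refine (abs_min_sub_min_le_max _ _ _ _).trans (max_le le_rfl ?_)
  rw [sub_sub_sub_cancel_left, abs_sub_comm]

theorem one_sub_mul_abs_foldMap_sub_le (hp : 1 / 2 ≤ p) (hx : x ≤ 1 / 2) (hy : y ≤ 1 / 2) :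
    (1 - x) * |foldMap p x - foldMap p y| ≤ 2 * (2 * p - 1) * |x - y| := by
  have hx' : 0 < 1 - x := by linarith
  have hy' : 0 < 1 - y := by linarith
  have hpq : 0 ≤ 2 * p - 1 := by linarith
  have hdiff : 1 - p + (2 * p - 1) * (x / (1 - x)) - (1 - p + (2 * p - 1) * (y / (1 - y))) =
      (2 * p - 1) / ((1 - x) * (1 - y)) * (x - y) := by
    field_simp
    ring
  calc (1 - x) * |foldMap p x - foldMap p y|
      ≤ (1 - x) * |(2 * p - 1) / ((1 - x) * (1 - y)) * (x - y)| := by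
        rw [← hdiff]
        exact mul_le_mul_of_nonneg_left (abs_foldBelief_sub_le _ _) hx'.le
    _ = (2 * p - 1) / (1 - y) * |x - y| := by
        rw [abs_mul, abs_of_nonneg (by positivity)]
        field_simp
    _ ≤ 2 * (2 * p - 1) * |x - y| := by
        gcongr
        rw [div_le_iff₀ hy']
        nlinarith

theorem abs_timeIter_sub_timeIter_le (hp : 1 / 2 ≤ p) (hp1 : p < 1) (hΛ : 0 ≤ Λ)
    (hΛ' : 1 / (1 - p) + 2 * (2 * p - 1) * Λ ≤ Λ) (n : ℕ) (hx : x ∈ Set.Icc (1 - p) (1 / 2))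
    (hy : y ∈ Set.Icc (1 - p) (1 / 2)) : |timeIter p n x - timeIter p n y| ≤ Λ * |x - y| := by
  induction n generalizing x y with
  | zero =>
    simp only [timeIter, sub_self, abs_zero]
    positivity
  | succ n ih =>
    have hx' := foldMap_mem_Icc hp ⟨by linarith [hx.1], hx.2⟩
    have hy' := foldMap_mem_Icc hp ⟨by linarith [hy.1], hy.2⟩
    have htime := timeIter_mem_Icc hp hp1 n hy'
    have hpos : 0 ≤ 1 - x := by linarith [hx.2]
    have hdiff : timeIter p (n + 1) x - timeIter p (n + 1) y =
        (1 - x) * (timeIter p n (foldMap p x) - timeIter p n (foldMap p y)) -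
          (x - y) * timeIter p n (foldMap p y) := by
      simp only [timeIter]
      ring
    calc |timeIter p (n + 1) x - timeIter p (n + 1) y|
        ≤ (1 - x) * |timeIter p n (foldMap p x) - timeIter p n (foldMap p y)| +
          |x - y| * timeIter p n (foldMap p y) := by
          rw [hdiff]
          refine (abs_sub _ _).trans_eq ?_
          rw [abs_mul, abs_mul, abs_of_nonneg hpos, abs_of_nonneg htime.1]
      _ ≤ (1 - x) * (Λ * |foldMap p x - foldMap p y|) + |x - y| * (1 / (1 - p)) := by
          gcongr
          exacts [ih hx' hy', htime.2]
      _ = Λ * ((1 - x) * |foldMap p x - foldMap p y|) + |x - y| * (1 / (1 - p)) := by ring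
      _ ≤ Λ * (2 * (2 * p - 1) * |x - y|) + |x - y| * (1 / (1 - p)) := by
          gcongr Λ * ?_ + _
          exact one_sub_mul_abs_foldMap_sub_le hp hx.2 hy.2
      _ = (1 / (1 - p) + 2 * (2 * p - 1) * Λ) * |x - y| := by ring
      _ ≤ Λ * |x - y| := by gcongr

theorem abs_revealTime_sub_le (hp : 1 / 2 ≤ p) (hp1 : p < 1) (hΛ : 0 ≤ Λ)
    (hΛ' : 1 / (1 - p) + 2 * (2 * p - 1) * Λ ≤ Λ) (hx : x ∈ Set.Icc (1 - p) (1 / 2))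
    (hy : y ∈ Set.Icc (1 - p) (1 / 2)) : |revealTime p x - revealTime p y| ≤ Λ * |x - y| :=
  le_of_tendsto' ((tendsto_timeIter hp hp1 hx).sub (tendsto_timeIter hp hp1 hy)).abs fun n =>
    abs_timeIter_sub_timeIter_le hp hp1 hΛ hΛ' n hx hy

/-- The expected reveal time as a positively homogeneous function of the masses of the states. -/
noncomputable def massTime (p : ℝ) (z : ℝ × ℝ) : ℝ :=
  (z.1 + z.2) * revealTime p (z.1 / (z.1 + z.2))

/-- The masses of the states whose belief is a folded belief that can occur after the first
stage. -/
def InCone (p : ℝ) (z : ℝ × ℝ) : Prop := ∃ x ∈ Set.Icc (1 - p) (1 / 2), HasOdds x z.1 z.2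

theorem HasOdds.massTime_eq (h : HasOdds x z.1 z.2) (p : ℝ) :
    massTime p z = (z.1 + z.2) * revealTime p x := by
  rw [massTime, h.eq_div]

theorem abs_massTime_sub_le (hp : 1 / 2 ≤ p) (hp1 : p < 1) (hΛ : 0 ≤ Λ)
    (hΛ' : 1 / (1 - p) + 2 * (2 * p - 1) * Λ ≤ Λ) (hz : InCone p z) (hw : InCone p w) :
    |massTime p z - massTime p w| ≤ 3 * Λ * (|z.1 - w.1| + |z.2 - w.2|) := by
  obtain ⟨x, hx, hzx⟩ := hz
  obtain ⟨y, hy, hwy⟩ := hw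
  have hmass : |z.1 - w.1 + (z.2 - w.2)| ≤ |z.1 - w.1| + |z.2 - w.2| := abs_add_le _ _
  have hyabs : |y| ≤ 1 := abs_le.2 ⟨by linarith [hy.1], by linarith [hy.2]⟩
  have htime : |revealTime p y| ≤ Λ := by
    obtain ⟨hnonneg, hle⟩ := revealTime_mem_Icc hp hp1 hy
    rw [abs_of_nonneg hnonneg]
    nlinarith
  have hbelief : (z.1 + z.2) * |x - y| ≤ |z.1 - w.1| + (|z.1 - w.1| + |z.2 - w.2|) := by
    have hdiff : (z.1 + z.2) * (x - y) = z.1 - w.1 - (z.1 - w.1 + (z.2 - w.2)) * y := by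
      linear_combination hzx.mul_add_eq - hwy.mul_add_eq
    rw [← abs_of_pos hzx.add_pos, ← abs_mul, hdiff]
    refine (abs_sub _ _).trans ?_
    rw [abs_mul]
    gcongr
    exact (mul_le_of_le_one_right (abs_nonneg _) hyabs).trans hmass
  calc |massTime p z - massTime p w|
      = |(z.1 + z.2) * (revealTime p x - revealTime p y) +
          (z.1 - w.1 + (z.2 - w.2)) * revealTime p y| := by
        rw [hzx.massTime_eq, hwy.massTime_eq]
        ring_nf
    _ ≤ (z.1 + z.2) * (Λ * |x - y|) + (|z.1 - w.1| + |z.2 - w.2|) * Λ := by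
        refine (abs_add_le _ _).trans ?_
        rw [abs_mul, abs_mul, abs_of_pos hzx.add_pos]
        have := hzx.add_pos.le
        gcongr
        exact abs_revealTime_sub_le hp hp1 hΛ hΛ' hx hy
    _ = Λ * ((z.1 + z.2) * |x - y|) + (|z.1 - w.1| + |z.2 - w.2|) * Λ := by ring
    _ ≤ Λ * (|z.1 - w.1| + (|z.1 - w.1| + |z.2 - w.2|)) + (|z.1 - w.1| + |z.2 - w.2|) * Λ := by
        gcongr
    _ ≤ 3 * Λ * (|z.1 - w.1| + |z.2 - w.2|) := by
        nlinarith [mul_nonneg hΛ (abs_nonneg (z.2 - w.2))]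

end Lipschitz

section SlopeBound

/-- The masses after a move of `σ*` that does not reveal the state. They are swapped if `b` is
false, that is, if the other state becomes the likelier one. -/
def massStep {K : Type*} [Ring K] (p : K) (b : Bool) (z : K × K) : K × K :=
  cond b ((2 * p - 1) * z.1 + (1 - p) * z.2, p * z.2 - (2 * p - 1) * z.1)
    (p * z.2 - (2 * p - 1) * z.1, (2 * p - 1) * z.1 + (1 - p) * z.2)

/-- `b` is a choice for which `massStep` keeps the first state the less likely one. -/
def IsBranch (b : Bool) (z : ℝ × ℝ) : Prop := cond b (2 * z.1 ≤ z.2) (z.2 ≤ 2 * z.1)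

/-- The branch at `z - δ • d` for all small positive `δ`. -/
def branchToward {K : Type*} [Ring K] [LinearOrder K] (z d : K × K) : Bool :=
  decide (2 * z.1 < z.2 ∨ 2 * z.1 = z.2 ∧ d.2 ≤ 2 * d.1)

/-- The lower bound for minus the directional derivative of `massTime` at `z` in the direction
`-d` that results from expanding `massTime` through `n` moves, where `L` is its Lipschitz
constant. -/
def slopeBound {K : Type*} [Ring K] [LinearOrder K] (p L : K) : ℕ → K × K → K × K → K
  | 0, _, d => -(L * (|d.1| + |d.2|))
  | n + 1, z, d => d.1 + d.2 +
      slopeBound p L n (massStep p (branchToward z d) z) (massStep p (branchToward z d) d)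

/-- The unnormalized `orbit`. -/
def massOrbit {K : Type*} [Ring K] [LinearOrder K] (p : K) : ℕ → K × K
  | 0 => (1 - p, p)
  | k + 1 => massStep p (decide (2 * (massOrbit p k).1 ≤ (massOrbit p k).2)) (massOrbit p k)

variable {p Λ x : ℝ} {b : Bool} {z d : ℝ × ℝ}

theorem massStep_fst_add_snd (p : ℝ) (b : Bool) (z : ℝ × ℝ) :
    (massStep p b z).1 + (massStep p b z).2 = z.2 := by
  cases b <;> simp only [massStep, cond_true, cond_false] <;> ring

theorem massStep_sub_smul (p : ℝ) (b : Bool) (z d : ℝ × ℝ) (δ : ℝ) :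
    massStep p b (z - δ • d) = massStep p b z - δ • massStep p b d := by
  cases b <;> ext <;>
    simp only [massStep, cond_true, cond_false, Prod.fst_sub, Prod.snd_sub, Prod.smul_fst,
      Prod.smul_snd, smul_eq_mul] <;> ring

theorem HasOdds.massStep (hp : 1 / 2 ≤ p) (h : HasOdds x z.1 z.2) (hx : x < 1)
    (hb : IsBranch b z) :
    HasOdds (foldMap p x) (massStep p b z).1 (massStep p b z).2 := by
  cases b
  · exact h.foldMap_of_ge hp hx hb
  · exact h.foldMap_of_le hp hx hb

theorem hasOdds_massOrbit (hp : 1 / 2 ≤ p) (hp1 : p ≤ 1) (k : ℕ) :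
    HasOdds (orbit p k) (massOrbit p k).1 (massOrbit p k).2 := by
  induction k with
  | zero => exact ⟨by simp [massOrbit], by simp [massOrbit, orbit_zero]⟩
  | succ k ih =>
    rw [orbit_succ]
    refine ih.massStep hp (by linarith [(orbit_mem_Icc hp hp1 k).2]) ?_
    rcases le_or_gt (2 * (massOrbit p k).1) (massOrbit p k).2 with h | h
    · rwa [decide_eq_true h]
    · rw [decide_eq_false h.not_ge]
      exact h.le

theorem InCone.massStep (hp : 1 / 2 ≤ p) (hp1 : p < 1) (h : InCone p z) (hb : IsBranch b z) :
    InCone p (massStep p b z) ∧ massTime p z = z.1 + z.2 + massTime p (massStep p b z) := by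
  obtain ⟨x, hx, hzx⟩ := h
  have hnext := hzx.massStep hp (by linarith [hx.2]) hb
  refine ⟨⟨_, foldMap_mem_Icc hp ⟨by linarith [hx.1], hx.2⟩, hnext⟩, ?_⟩
  rw [hzx.massTime_eq, hnext.massTime_eq, massStep_fst_add_snd,
    (isRevealTime_revealTime hp hp1).eq_one_add x hx]
  linear_combination -revealTime p (foldMap p x) * hzx.mul_add_eq

theorem eventually_sub_mul_le_sub_mul {u v a b : ℝ} (h : u < v ∨ u = v ∧ b ≤ a) :
    ∀ᶠ δ in nhdsWithin (0 : ℝ) (Set.Ioi 0), u - δ * a ≤ v - δ * b := by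
  rcases h with h | ⟨rfl, h⟩
  · have htendsto (u a : ℝ) :
        Tendsto (fun δ : ℝ => u - δ * a) (nhdsWithin 0 (Set.Ioi 0)) (nhds u) :=
      (Continuous.tendsto' (by fun_prop) 0 u (by simp)).mono_left nhdsWithin_le_nhds
    exact ((htendsto u a).eventually_lt (htendsto v b) h).mono fun δ => le_of_lt
  · filter_upwards [self_mem_nhdsWithin] with δ hδ
    have := mul_le_mul_of_nonneg_left h (le_of_lt hδ)
    linarith

theorem isBranch_branchToward (z d : ℝ × ℝ) : IsBranch (branchToward z d) z ∧
    ∀ᶠ δ in nhdsWithin (0 : ℝ) (Set.Ioi 0), IsBranch (branchToward z d) (z - δ • d) := by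
  by_cases h : 2 * z.1 < z.2 ∨ 2 * z.1 = z.2 ∧ d.2 ≤ 2 * d.1
  · rw [branchToward, decide_eq_true h]
    refine ⟨h.elim le_of_lt fun h => h.1.le, (eventually_sub_mul_le_sub_mul h).mono fun δ hδ => ?_⟩
    simp only [IsBranch, cond_true, Prod.fst_sub, Prod.snd_sub, Prod.smul_fst, Prod.smul_snd,
      smul_eq_mul]
    linarith
  · rw [branchToward, decide_eq_false h]
    replace h : z.2 < 2 * z.1 ∨ z.2 = 2 * z.1 ∧ 2 * d.1 ≤ d.2 := by grind
    refine ⟨h.elim le_of_lt fun h => h.1.le, (eventually_sub_mul_le_sub_mul h).mono fun δ hδ => ?_⟩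
    simp only [IsBranch, cond_false, Prod.fst_sub, Prod.snd_sub, Prod.smul_fst, Prod.smul_snd,
      smul_eq_mul]
    linarith

theorem mul_slopeBound_le (hp : 1 / 2 ≤ p) (hp1 : p < 1) (hΛ : 0 ≤ Λ)
    (hΛ' : 1 / (1 - p) + 2 * (2 * p - 1) * Λ ≤ Λ) (n : ℕ) (hz : InCone p z)
    (hd : ∀ᶠ δ in nhdsWithin (0 : ℝ) (Set.Ioi 0), InCone p (z - δ • d)) :
    ∀ᶠ δ in nhdsWithin (0 : ℝ) (Set.Ioi 0),
      δ * slopeBound p (3 * Λ) n z d ≤ massTime p z - massTime p (z - δ • d) := by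
  induction n generalizing z d with
  | zero =>
    filter_upwards [hd, self_mem_nhdsWithin] with δ hδ hpos
    have habs := (abs_le.1 (abs_massTime_sub_le hp hp1 hΛ hΛ' hz hδ)).1
    simp only [Prod.fst_sub, Prod.snd_sub, Prod.smul_fst, Prod.smul_snd, smul_eq_mul,
      sub_sub_cancel, abs_mul, abs_of_pos (show 0 < δ from hpos)] at habs
    simp only [slopeBound]
    linarith
  | succ n ih =>
    obtain ⟨hbranch, hbranch'⟩ := isBranch_branchToward z d
    have hstep := (hd.and hbranch').mono fun δ hδ => hδ.1.massStep hp hp1 hδ.2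
    simp only [massStep_sub_smul] at hstep
    obtain ⟨hcone, htime⟩ := hz.massStep hp hp1 hbranch
    filter_upwards [hstep, ih hcone (hstep.mono fun δ hδ => hδ.1)] with δ hδ hslope
    rw [htime, hδ.2, slopeBound]
    simp only [Prod.fst_sub, Prod.snd_sub, Prod.smul_fst, Prod.smul_snd, smul_eq_mul]
    linarith

theorem HasOdds.smul (h : HasOdds x z.1 z.2) {c : ℝ} (hc : 0 < c) :
    HasOdds x (c • z).1 (c • z).2 := by
  simp only [Prod.smul_fst, Prod.smul_snd, smul_eq_mul]
  refine ⟨by rw [← mul_add]; exact mul_pos hc h.add_pos, ?_⟩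
  rw [← mul_add, mul_div_mul_left _ _ hc.ne', h.eq_div]

theorem massTime_le_neg_slopeBound (hp : 1 / 2 ≤ p) (hp1 : p < 1) (hΛ : 0 ≤ Λ)
    (hΛ' : 1 / (1 - p) + 2 * (2 * p - 1) * Λ ≤ Λ) (n : ℕ) (hz : InCone p z) :
    massTime p z ≤ -slopeBound p (3 * Λ) n z (-z) := by
  have hscale (δ : ℝ) : z - δ • -z = (1 + δ) • z := by module
  have hcone : ∀ᶠ δ in nhdsWithin (0 : ℝ) (Set.Ioi 0), InCone p (z - δ • -z) := by
    filter_upwards [self_mem_nhdsWithin] with δ hδ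
    obtain ⟨x, hx, hzx⟩ := hz
    exact ⟨x, hx, hscale δ ▸ hzx.smul (by linarith [show 0 < δ from hδ])⟩
  obtain ⟨δ, hslope, hδ⟩ := ((mul_slopeBound_le hp hp1 hΛ hΛ' n hz hcone).and
    self_mem_nhdsWithin).exists
  replace hδ : 0 < δ := hδ
  obtain ⟨x, -, hzx⟩ := hz
  have htime : massTime p (z - δ • -z) = (1 + δ) * massTime p z := by
    rw [hscale, (hzx.smul (by linarith)).massTime_eq, hzx.massTime_eq]
    simp only [Prod.smul_fst, Prod.smul_snd, smul_eq_mul]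
    ring
  rw [htime] at hslope
  exact le_of_mul_le_mul_left (by linarith) hδ

theorem tendsto_mul_left_nhdsGT_zero {c : ℝ} (hc : 0 < c) :
    Tendsto (fun δ : ℝ => c * δ) (nhdsWithin 0 (Set.Ioi 0)) (nhdsWithin 0 (Set.Ioi 0)) :=
  tendsto_iff_comap.2 (comap_mulLeft_nhdsGT_zero hc).ge

/-- `ℓ` decreases to the right of `x` at rate at least `k`. -/
def HasRightDecrease (ℓ : ℝ → ℝ) (x k : ℝ) : Prop :=
  ∀ᶠ δ in nhdsWithin (0 : ℝ) (Set.Ioi 0), δ * k ≤ ℓ x - ℓ (x + δ)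

theorem HasOdds.hasRightDecrease_revealTime (hp : 1 / 2 ≤ p) (hp1 : p < 1) (hΛ : 0 ≤ Λ)
    (hΛ' : 1 / (1 - p) + 2 * (2 * p - 1) * Λ ≤ Λ) (n : ℕ) (h : HasOdds x z.1 z.2)
    (hx : x ∈ Set.Ico (1 - p) (1 / 2)) :
    HasRightDecrease (revealTime p) x (slopeBound p (3 * Λ) n z (-1, 1)) := by
  have hS := h.add_pos
  have hodds (δ : ℝ) : HasOdds (x + δ) (z - ((z.1 + z.2) * δ) • ((-1 : ℝ), (1 : ℝ))).1
      (z - ((z.1 + z.2) * δ) • ((-1 : ℝ), (1 : ℝ))).2 := by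
    simp only [Prod.fst_sub, Prod.snd_sub, Prod.smul_fst, Prod.smul_snd, smul_eq_mul]
    refine ⟨by linarith, ?_⟩
    rw [eq_div_iff (by linarith)]
    linear_combination h.mul_add_eq
  have hcone : ∀ᶠ δ in nhdsWithin (0 : ℝ) (Set.Ioi 0),
      InCone p (z - δ • ((-1 : ℝ), (1 : ℝ))) := by
    have hgap : 0 < (z.1 + z.2) * (1 / 2 - x) := mul_pos hS (by linarith [hx.2])
    filter_upwards [Ioo_mem_nhdsGT hgap] with δ hδ
    have hle : δ / (z.1 + z.2) < 1 / 2 - x := (div_lt_iff₀' hS).2 hδ.2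
    have hpos : 0 < δ / (z.1 + z.2) := div_pos hδ.1 hS
    refine ⟨x + δ / (z.1 + z.2), ⟨by linarith [hx.1], by linarith⟩, ?_⟩
    simpa only [mul_div_cancel₀ _ hS.ne'] using hodds (δ / (z.1 + z.2))
  filter_upwards [(tendsto_mul_left_nhdsGT_zero hS).eventually
    (mul_slopeBound_le hp hp1 hΛ hΛ' n ⟨x, ⟨hx.1, hx.2.le⟩, h⟩ hcone)] with δ hδ
  rw [h.massTime_eq, (hodds δ).massTime_eq] at hδ
  simp only [Prod.fst_sub, Prod.snd_sub, Prod.smul_fst, Prod.smul_snd, smul_eq_mul] at hδ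
  refine le_of_mul_le_mul_left ?_ hS
  linarith

end SlopeBound

section BadParameter

/-- A pair of rationals as a pair of reals. -/
def castPair (z : ℚ × ℚ) : ℝ × ℝ := (z.1, z.2)

theorem massStep_castPair (p : ℚ) (b : Bool) (z : ℚ × ℚ) :
    massStep (p : ℝ) b (castPair z) = castPair (massStep p b z) := by
  cases b <;> ext <;> simp [massStep, castPair]

theorem branchToward_castPair (z d : ℚ × ℚ) :
    branchToward (castPair z) (castPair d) = branchToward z d := by
  simp only [branchToward, castPair]
  norm_cast

theorem slopeBound_castPair (p L : ℚ) (n : ℕ) (z d : ℚ × ℚ) :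
    slopeBound (p : ℝ) L n (castPair z) (castPair d) = slopeBound p L n z d := by
  induction n generalizing z d with
  | zero => simp [slopeBound, castPair]
  | succ n ih =>
    simp only [slopeBound, branchToward_castPair, massStep_castPair, ih, Rat.cast_add]
    rfl

theorem massOrbit_cast (p : ℚ) (k : ℕ) : massOrbit (p : ℝ) k = castPair (massOrbit p k) := by
  induction k with
  | zero => simp [massOrbit, castPair]
  | succ k ih =>
    rw [massOrbit, massOrbit, ih, massStep_castPair]
    congr 2
    simp only [castPair]
    norm_cast

/-- A parameter for which `σ*` is not optimal. -/
def badParam : ℚ := 0.73275300915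

theorem massOrbit_badParam :
    (massOrbit badParam 57).2 < 2 * (massOrbit badParam 57).1 ∧
      (massOrbit badParam 57).1 < (massOrbit badParam 57).2 ∧
      (massOrbit badParam 58).1 < (massOrbit badParam 58).2 := by
  decide +kernel

theorem neg_slopeBound_badParam_lt :
    -slopeBound badParam 165 60 (massOrbit badParam 0) (-massOrbit badParam 0) <
      (2 * badParam - 1) * (slopeBound badParam 165 60 (massOrbit badParam 0) (-1, 1) +
        slopeBound badParam 165 60 (massOrbit badParam 58) (-1, 1)) := by
  decide +kernel

theorem half_le_badParam : 1 / 2 ≤ (badParam : ℝ) := by norm_num [badParam]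

theorem badParam_lt_one : (badParam : ℝ) < 1 := by norm_num [badParam]

theorem orbit_badParam_lt_half {k : ℕ}
    (h : (massOrbit badParam k).1 < (massOrbit badParam k).2) :
    orbit (badParam : ℝ) k < 1 / 2 := by
  have hodds := hasOdds_massOrbit half_le_badParam badParam_lt_one.le k
  rw [massOrbit_cast] at hodds
  rw [hodds.eq_div, div_lt_iff₀ hodds.add_pos]
  have : ((massOrbit badParam k).1 : ℝ) < (massOrbit badParam k).2 := by exact_mod_cast h
  simp only [castPair]
  linarith

theorem third_lt_orbit_badParam {k : ℕ}
    (h : (massOrbit badParam k).2 < 2 * (massOrbit badParam k).1) :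
    1 / 3 < orbit (badParam : ℝ) k := by
  have hodds := hasOdds_massOrbit half_le_badParam badParam_lt_one.le k
  rw [massOrbit_cast] at hodds
  refine hodds.third_lt ?_
  simp only [castPair]
  exact_mod_cast h

theorem hasRightDecrease_orbit_badParam {k : ℕ}
    (h : (massOrbit badParam k).1 < (massOrbit badParam k).2) :
    HasRightDecrease (revealTime badParam) (orbit badParam k)
      (slopeBound badParam 165 60 (massOrbit badParam k) (-1, 1) : ℚ) := by
  have hp1 := badParam_lt_one
  have hodds := hasOdds_massOrbit half_le_badParam hp1.le k
  convert hodds.hasRightDecrease_revealTime half_le_badParam hp1 (Λ := 55) (by norm_num)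
    (by norm_num [badParam]) 60
    ⟨(orbit_mem_Icc half_le_badParam hp1.le k).1, orbit_badParam_lt_half h⟩ using 1
  rw [massOrbit_cast, ← slopeBound_castPair]
  norm_num [castPair]

theorem revealTime_badParam_lt : revealTime badParam (1 - badParam) < (2 * badParam - 1) *
    ((slopeBound badParam 165 60 (massOrbit badParam 0) (-1, 1) : ℚ) +
      (slopeBound badParam 165 60 (massOrbit badParam 58) (-1, 1) : ℚ)) := by
  have hp := half_le_badParam
  have hp1 := badParam_lt_one
  have hodds := hasOdds_massOrbit hp hp1.le 0
  have hle := massTime_le_neg_slopeBound hp hp1 (Λ := 55) (by norm_num)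
    (by norm_num [badParam]) 60 ⟨_, orbit_mem_Icc hp hp1.le 0, hodds⟩
  rw [hodds.massTime_eq] at hle
  calc revealTime badParam (1 - badParam)
      ≤ ((-slopeBound badParam 165 60 (massOrbit badParam 0) (-massOrbit badParam 0) : ℚ) : ℝ) := by
        rw [Rat.cast_neg, ← slopeBound_castPair]
        convert hle using 1
        · simp [massOrbit, orbit_zero]
        · rw [massOrbit_cast]
          norm_num [castPair]
    _ < _ := by exact_mod_cast neg_slopeBound_badParam_lt

end BadParameter

/-! ### Improving on σ* -/

section Improvement

theorem transition_mem_unitInterval {p t : ℝ} (hp : p ∈ unitInterval) (ht : t ∈ unitInterval) :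
    1 - p + (2 * p - 1) * t ∈ unitInterval := by
  obtain ⟨hp0, hp1⟩ := hp
  obtain ⟨ht0, ht1⟩ := ht
  constructor <;> nlinarith

/-- The equalizing strategy with stage gain `g`; every nonnegative `g` up to the gain of `σ*` is
possible. -/
noncomputable def EqualizingStrategy.ofStageGain (p : unitInterval) (g : unitInterval → ℝ)
    (hg : ∀ θ : unitInterval, g θ ∈ Set.Icc 0 (foldBelief θ)) : EqualizingStrategy p :=
  have hleft (θ : unitInterval) : g θ / θ ∈ unitInterval :=
    unitInterval.div_mem (hg θ).1 θ.2.1 ((hg θ).2.trans (min_le_left _ _))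
  have hright (θ : unitInterval) : g θ / (1 - θ) ∈ unitInterval :=
    unitInterval.div_mem (hg θ).1 (by linarith [θ.2.2]) ((hg θ).2.trans (min_le_right _ _))
  have hleft' (θ : unitInterval) : θ * (g θ / θ) = g θ :=
    mul_div_cancel_of_imp' fun h =>
      (hg θ).1.antisymm' (((hg θ).2.trans (min_le_left _ _)).trans h.le)
  have hright' (θ : unitInterval) : (1 - θ) * (g θ / (1 - θ)) = g θ :=
    mul_div_cancel_of_imp' fun h =>
      (hg θ).1.antisymm' (((hg θ).2.trans (min_le_right _ _)).trans h.le)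
  { play θ s := match s with
      | State.low => ⟨g θ / θ, hleft θ⟩
      | State.high => unitInterval.symm ⟨g θ / (1 - θ), hright θ⟩
    update θ a := match a with
      | Move1.T => ⟨_, transition_mem_unitInterval p.2 (hright θ)⟩
      | Move1.B => unitInterval.symm ⟨_, transition_mem_unitInterval p.2 (hleft θ)⟩
    stageGain := g
    gain_left θ := hleft' θ
    gain_right θ := by
      rw [unitInterval.coe_symm_eq, sub_sub_cancel, hright']
    update_top θ := by linear_combination (2 * (p : ℝ) - 1) * hright' θ
    update_bottom θ := by
      rw [unitInterval.coe_symm_eq]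
      linear_combination (1 - 2 * (p : ℝ)) * hleft' θ }

/-- The modification of `σ*` that reveals less when the folded belief is `x`. -/
noncomputable def revealLess (p : unitInterval) {x η : ℝ} (hη : η ∈ Set.Icc 0 x) :
    EqualizingStrategy p :=
  .ofStageGain p (fun θ => if foldBelief θ = x then x - η else foldBelief θ) fun θ => by
    split_ifs with h
    · exact ⟨by linarith [hη.2], by linarith [hη.1]⟩
    · exact ⟨(foldBelief_mem_Icc θ).1, le_rfl⟩

theorem EqualizingStrategy.beliefDrift_add_const_mul {p : ℝ} (E : EqualizingStrategy p)
    (H B : unitInterval → ℝ) (c : ℝ) (θ : unitInterval) :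
    E.beliefDrift (fun θ => H θ + c * B θ) θ =
      E.beliefDrift H θ + c * (E.beliefDrift B θ - E.stageGain θ) := by
  simp only [beliefDrift]
  ring

theorem EqualizingStrategy.neg_one_le_beliefDrift_sub_stageGain {p : ℝ} (hp : 1 / 2 ≤ p)
    (E : EqualizingStrategy p) {B : ℝ → ℝ} (hB : ∀ z, |B z| ≤ 1)
    (hB0 : ∀ z ∈ Set.Icc (1 - p) (1 / 2), 0 ≤ B z) (θ : unitInterval) :
    -1 ≤ E.beliefDrift (fun θ => B (foldBelief θ)) θ - E.stageGain θ := by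
  obtain ⟨hx0, hx2⟩ := foldBelief_mem_Icc θ
  obtain ⟨hg0, hgx⟩ := E.stageGain_mem_Icc θ
  have hone : 0 ≤ 1 - foldBelief θ := by linarith
  have hfar := hB0 _ (foldStep_mem_Icc hp (unitInterval.div_mem hg0 hone (by linarith)))
  have hnear := hB0 _ (foldStep_mem_Icc hp (unitInterval.div_mem hg0 hx0 hgx))
  rw [E.beliefDrift_foldBelief]
  linarith [mul_nonneg hone hfar, mul_nonneg hx0 hnear, (abs_le.1 (hB (foldBelief θ))).2]

open Classical in
/-- The function `3⁻ʲ`, where `j` is the number of steps that `F` takes from `x` to `y`; it is `0`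
at the points whose orbit does not meet `y`. -/
noncomputable def hittingWeight {α : Type*} (F : α → α) (y x : α) : ℝ :=
  if h : ∃ j, F^[j] x = y then (1 / 3) ^ Nat.find h else 0

variable {α : Type*} {F : α → α} {x y : α}

theorem hittingWeight_mem_unitInterval : hittingWeight F y x ∈ unitInterval := by
  unfold hittingWeight
  split_ifs
  · exact ⟨by positivity, pow_le_one₀ (by norm_num) (by norm_num)⟩
  · exact unitInterval.zero_mem

open Classical in
theorem pow_le_hittingWeight {j : ℕ} (h : F^[j] x = y) : (1 / 3) ^ j ≤ hittingWeight F y x := by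
  rw [hittingWeight, dif_pos ⟨j, h⟩]
  exact pow_le_pow_of_le_one (by norm_num) (by norm_num) (Nat.find_min' _ h)

open Classical in
theorem three_mul_hittingWeight_le (hx : x ≠ y) :
    3 * hittingWeight F y x ≤ hittingWeight F y (F x) := by
  by_cases h : ∃ j, F^[j] x = y
  · obtain ⟨j, hj⟩ := Nat.exists_eq_succ_of_ne_zero fun h0 => hx ((Nat.find_eq_zero h).1 h0)
    have hspec := Nat.find_spec h
    rw [hj, Function.iterate_succ_apply] at hspec
    rw [hittingWeight, dif_pos h, hj, pow_succ]
    linarith [pow_le_hittingWeight hspec]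
  · rw [hittingWeight, dif_neg h, mul_zero]
    exact hittingWeight_mem_unitInterval.1

theorem exists_bonus {p : ℝ} (hp : 1 / 2 ≤ p) (hp1 : p < 1) (N : ℕ) :
    ∃ (B : ℝ → ℝ) (ε : ℝ), 0 < ε ∧ ε ≤ 1 ∧ (∀ z, |B z| ≤ 1) ∧
      (∀ z ∈ Set.Icc (1 - p) (1 / 2), 0 ≤ B z) ∧
      ∀ z ∈ Set.Icc (0 : ℝ) (1 / 2), z ≠ orbit p N →
        ε ≤ (1 - z) * B (foldMap p z) + z * B (1 - p) - B z := by
  let β := hittingWeight (foldMap p) (orbit p N)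
  let B (z : ℝ) : ℝ := if 1 - p ≤ z then β z else -1
  have hβ (z : ℝ) : β z ∈ unitInterval := hittingWeight_mem_unitInterval
  have hBβ {z : ℝ} (hz : 1 - p ≤ z) : B z = β z := if_pos hz
  have hstart : (1 / 3) ^ N ≤ β (1 - p) := pow_le_hittingWeight rfl
  have hpow : (0 : ℝ) < (1 / 3) ^ N := by positivity
  refine ⟨B, (1 - p) * (1 / 3) ^ N, mul_pos (by linarith) hpow,
    mul_le_one₀ (by linarith) hpow.le (pow_le_one₀ (by norm_num) (by norm_num)), fun z => ?_,
    fun z hz => (hBβ hz.1).symm ▸ (hβ z).1, fun z hz hne => ?_⟩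
  · by_cases hz : 1 - p ≤ z
    · rw [hBβ hz, abs_of_nonneg (hβ z).1]
      exact (hβ z).2
    · simp only [B, if_neg hz, abs_neg, abs_one, le_refl]
  · rw [hBβ (foldMap_mem_Icc hp hz).1, hBβ le_rfl]
    have hone : 0 ≤ 1 - z := by linarith [hz.2]
    by_cases hzp : 1 - p ≤ z
    · rw [hBβ hzp]
      have htriple : (1 - z) * (3 * β z) ≤ (1 - z) * β (foldMap p z) :=
        mul_le_mul_of_nonneg_left (three_mul_hittingWeight_le hne) hone
      have hgain : (1 - p) * (1 / 3) ^ N ≤ z * β (1 - p) := mul_le_mul hzp hstart hpow.le hz.1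
      have hrest : 0 ≤ (2 - 3 * z) * β z := mul_nonneg (by linarith [hz.2]) (hβ z).1
      linarith
    · have hB : B z = -1 := if_neg hzp
      have hle : (1 - p) * (1 / 3) ^ N ≤ 1 :=
        mul_le_one₀ (by linarith) hpow.le (pow_le_one₀ (by norm_num) (by norm_num))
      linarith [mul_nonneg hone (hβ (foldMap p z)).1, mul_nonneg hz.1 (hβ (1 - p)).1]

theorem EqualizingStrategy.exists_lt_guarantees1 {p : unitInterval} (hp : 1 / 2 ≤ (p : ℝ))
    (hp1 : (p : ℝ) < 1) (E : EqualizingStrategy p) {N : ℕ}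
    (hE : ∀ θ : unitInterval, foldBelief θ ≠ orbit p N → E.stageGain θ = foldBelief θ)
    {H : unitInterval → ℝ} {C v κ : ℝ} (hH : ∀ θ, |H θ| ≤ C) (hκ : 0 < κ)
    (hle : ∀ θ : unitInterval, foldBelief θ ≠ orbit p N → v ≤ E.beliefDrift H θ)
    (hlt : ∀ θ : unitInterval, foldBelief θ = orbit p N → v + κ ≤ E.beliefDrift H θ)
    (θ₀ : unitInterval) : ∃ v', v < v' ∧ Guarantees1 p θ₀ (E.strategy θ₀) v' := by
  obtain ⟨B, ε, hε, hε1, hB, hB0, hbonus⟩ := exists_bonus hp hp1 N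
  have hbound (θ : unitInterval) : |H θ + κ / 2 * B (foldBelief θ)| ≤ C + κ / 2 * 1 := by
    refine (abs_add_le _ _).trans (add_le_add (hH θ) ?_)
    rw [abs_mul, abs_of_pos (half_pos hκ)]
    exact mul_le_mul_of_nonneg_left (hB _) (half_pos hκ).le
  refine ⟨v + κ / 2 * ε, by linarith [mul_pos (half_pos hκ) hε],
    E.guarantees1 hbound (fun θ => ?_) θ₀⟩
  rw [E.beliefDrift_add_const_mul H (fun θ => B (foldBelief θ))]
  by_cases hθ : foldBelief θ = orbit p N
  · have hloss := E.neg_one_le_beliefDrift_sub_stageGain hp hB hB0 θ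
    nlinarith [hlt θ hθ]
  · refine add_le_add (hle θ hθ) (mul_le_mul_of_nonneg_left ?_ (half_pos hκ).le)
    rw [E.beliefDrift_of_stageGain_eq hp B (hE θ hθ), hE θ hθ]
    linarith [hbonus _ (foldBelief_mem_Icc θ) hθ]

theorem foldStep_sub_div_one_sub {p x η : ℝ} (hp : 1 / 2 ≤ p) (hx : 1 / 3 ≤ x) (hx1 : x < 1)
    (hη : 2 * η ≤ 3 * x - 1) :
    foldStep p ((x - η) / (1 - x)) = foldMap p x + (2 * p - 1) / (1 - x) * η := by
  rw [foldMap_of_ge hp hx hx1,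
    foldStep_of_ge hp ((le_div_iff₀ (by linarith)).2 (by linarith))]
  ring

theorem foldStep_sub_div_self {p x η : ℝ} (hp : 1 / 2 ≤ p) (hx : 0 < x) (hη : 2 * η ≤ x) :
    foldStep p ((x - η) / x) = 1 - p + (2 * p - 1) / x * η := by
  rw [foldStep_of_ge hp ((le_div_iff₀ hx).2 (by linarith))]
  field_simp
  ring

theorem eventually_mul_le_sub_foldStep {p x K K' : ℝ} {ℓ : ℝ → ℝ} (hp : 1 / 2 < p)
    (hx : x ∈ Set.Ioo (1 / 3) (1 / 2)) (hK : HasRightDecrease ℓ (1 - p) K)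
    (hK' : HasRightDecrease ℓ (foldMap p x) K') :
    ∀ᶠ η in nhdsWithin (0 : ℝ) (Set.Ioi 0), η * ((2 * p - 1) * (K + K')) ≤
      (1 - x) * (ℓ (foldMap p x) - ℓ (foldStep p ((x - η) / (1 - x)))) +
        x * (ℓ (1 - p) - ℓ (foldStep p ((x - η) / x))) := by
  obtain ⟨hx3, hx2⟩ := hx
  have hp0 : 0 < 2 * p - 1 := by linarith
  have hx0 : 0 < x := by linarith
  have hx1 : 0 < 1 - x := by linarith
  filter_upwards [(tendsto_mul_left_nhdsGT_zero (div_pos hp0 hx1)).eventually hK',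
    (tendsto_mul_left_nhdsGT_zero (div_pos hp0 hx0)).eventually hK,
    Ioo_mem_nhdsGT (show 0 < (3 * x - 1) / 2 by linarith)] with η hfar hnear hη
  have hη2 : η < (3 * x - 1) / 2 := hη.2
  rw [foldStep_sub_div_one_sub hp.le hx3.le (by linarith) (by linarith),
    foldStep_sub_div_self hp.le hx0 (by linarith)]
  calc η * ((2 * p - 1) * (K + K'))
      = (1 - x) * ((2 * p - 1) / (1 - x) * η * K') + x * ((2 * p - 1) / x * η * K) := by
        field_simp
        ring
    _ ≤ _ := add_le_add (mul_le_mul_of_nonneg_left hfar hx1.le)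
        (mul_le_mul_of_nonneg_left hnear hx0.le)

theorem IsRevealTime.exists_lt_guarantees1 {p : unitInterval} (hp : 1 / 2 < (p : ℝ))
    (hp1 : (p : ℝ) < 1) {ℓ : ℝ → ℝ} (hℓ : IsRevealTime p ℓ) (hpos : 0 < ℓ (1 - p)) {N : ℕ}
    {K K' : ℝ} (hx : orbit p N ∈ Set.Ioo (1 / 3 : ℝ) (1 / 2))
    (hK : HasRightDecrease ℓ (1 - p) K) (hK' : HasRightDecrease ℓ (orbit p (N + 1)) K')
    (hlt : ℓ (1 - p) < (2 * p - 1) * (K + K')) (θ₀ : unitInterval) :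
    ∃ (σ : Strategy1) (v : ℝ), (ℓ (1 - p))⁻¹ < v ∧ Guarantees1 p θ₀ σ v := by
  rw [orbit_succ] at hK'
  set x := orbit p N
  set v := (ℓ (1 - p))⁻¹
  have hv : v * ℓ (1 - p) = 1 := inv_mul_cancel₀ hpos.ne'
  have hv0 : 0 < v := inv_pos.2 hpos
  obtain ⟨η, hslope, hη⟩ := ((eventually_mul_le_sub_foldStep hp hx hK hK').and
    (Ioo_mem_nhdsGT (show 0 < x by linarith [hx.1]))).exists
  let E := revealLess p (Set.Ioo_subset_Icc_self hη)
  have hE (θ : unitInterval) (hθ : foldBelief θ ≠ x) : E.stageGain θ = foldBelief θ := if_neg hθ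
  have hEx (θ : unitInterval) (hθ : foldBelief θ = x) : E.stageGain θ = x - η := if_pos hθ
  have hκ : 0 < η * (v * ((2 * p - 1) * (K + K')) - 1) :=
    mul_pos hη.1 (by linarith [mul_lt_mul_of_pos_left hlt hv0])
  obtain ⟨C, hC⟩ := hℓ.exists_abs_starPotential_le hp.le v
  obtain ⟨v', hv', hguar⟩ := E.exists_lt_guarantees1 hp.le hp1 hE hC hκ
    (fun θ hθ => (hℓ.beliefDrift_starPotential_of_eq hp.le hv E (hE θ hθ)).ge) (fun θ hθ => by
      rw [hℓ.beliefDrift_starPotential hp.le hv E hθ (hEx θ hθ)]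
      linarith [mul_le_mul_of_nonneg_left hslope hv0.le]) θ₀
  exact ⟨_, v', hv', hguar⟩

end Improvement

theorem exists_guarantees1_badParam {p : unitInterval} (hp : (p : ℝ) = badParam)
    (θ₀ : unitInterval) : ∃ (σ : Strategy1) (v : ℝ), Guarantees1 p θ₀ σ v ∧
      ¬ Guarantees1 p θ₀ (sigmaStar p θ₀) v := by
  have hhalf : 1 / 2 < (p : ℝ) := by norm_num [hp, badParam]
  have hp1 : (p : ℝ) < 1 := hp ▸ badParam_lt_one
  have hℓ := isRevealTime_revealTime hhalf.le hp1
  have hpos : 0 < revealTime p (1 - p) :=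
    one_pos.trans_le (one_le_revealTime hhalf.le hp1 ⟨by linarith, by linarith⟩)
  obtain ⟨σ, v, hlt, hσ⟩ := hℓ.exists_lt_guarantees1 hhalf hp1 hpos (N := 57)
    (hp ▸ ⟨third_lt_orbit_badParam massOrbit_badParam.1,
      orbit_badParam_lt_half massOrbit_badParam.2.1⟩)
    (hp ▸ hasRightDecrease_orbit_badParam (k := 0) (by norm_num [massOrbit, badParam]))
    (hp ▸ hasRightDecrease_orbit_badParam massOrbit_badParam.2.2)
    (hp ▸ revealTime_badParam_lt) θ₀
  exact ⟨σ, v, hσ, fun h => ((hℓ.guarantees1_sigmaStar_iff hhalf.le hpos.ne').1 h).not_gt hlt⟩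

theorem IsOptimal.guarantees1_of_guarantees1 {p θ₀ : unitInterval} {σ σ' : Strategy1} {v : ℝ}
    (h : IsOptimal p θ₀ σ) (hσ' : Guarantees1 p θ₀ σ' v) : Guarantees1 p θ₀ σ v := by
  obtain ⟨w, ⟨-, τ, hτ⟩, hσ⟩ := h
  have hvw : v ≤ w := (hσ' τ).trans (liminf_avgGain_le_limsup_avgGain.trans (hτ σ'))
  exact fun τ => hvw.trans (hσ τ)

theorem sigmaStarOptimal_of_le {p : unitInterval} (hp : 1 / 2 ≤ (p : ℝ))
    (hp' : (p : ℝ) ≤ 0.7191) : SigmaStarOptimal p :=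
  (le_or_gt (p : ℝ) (2 / 3)).elim (sigmaStarOptimal_of_le_two_thirds hp)
    fun h => sigmaStarOptimal_of_two_thirds_lt h hp'

theorem badParam_mem_unitInterval : (badParam : ℝ) ∈ unitInterval :=
  ⟨by linarith [half_le_badParam], badParam_lt_one.le⟩

theorem le_criticalParameter {q : ℝ} (hq : 1 / 2 ≤ q) (hq1 : q ≤ 1)
    (h : ∀ p : unitInterval, 1 / 2 ≤ (p : ℝ) → (p : ℝ) ≤ q → SigmaStarOptimal p) :
    q ≤ criticalParameter :=
  le_csSup ⟨1, fun _ hr => hr.2.1⟩ ⟨hq, hq1, h⟩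

theorem criticalParameter_le {p : unitInterval} (hp : 1 / 2 ≤ (p : ℝ))
    (h : ¬ SigmaStarOptimal p) : criticalParameter ≤ p :=
  Real.sSup_le (fun _ hq => le_of_not_gt fun hlt => h (hq.2.2 p hp hlt.le)) p.2.1

end RenaultGame

theorem theorem1 :
    (∀ p : unitInterval, 1 / 2 ≤ (p : ℝ) → (p : ℝ) < 0.719 →
      RenaultGame.SigmaStarOptimal p) ∧
    (∃ p : unitInterval, (p : ℝ) = 0.73275300915 ∧
      ∀ θ₀ : unitInterval,
        ¬ RenaultGame.IsOptimal p θ₀ (RenaultGame.sigmaStar p θ₀) ∧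
        ∃ (σ : RenaultGame.Strategy1) (v : ℝ),
          RenaultGame.Guarantees1 p θ₀ σ v ∧
          ¬ RenaultGame.Guarantees1 p θ₀ (RenaultGame.sigmaStar p θ₀) v) ∧
    0.719 < RenaultGame.criticalParameter ∧
    RenaultGame.criticalParameter < 0.733 := by
  let p : unitInterval := ⟨_, RenaultGame.badParam_mem_unitInterval⟩
  have hbetter (θ₀ : unitInterval) := RenaultGame.exists_guarantees1_badParam (p := p) rfl θ₀
  have hnot (θ₀ : unitInterval) : ¬ RenaultGame.IsOptimal p θ₀ (RenaultGame.sigmaStar p θ₀) :=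
    fun h =>
      have ⟨_, _, hσ, hstar⟩ := hbetter θ₀
      hstar (h.guarantees1_of_guarantees1 hσ)
  refine ⟨fun p hp hp' => RenaultGame.sigmaStarOptimal_of_le hp (hp'.le.trans (by norm_num)),
    ⟨p, by norm_num [p, RenaultGame.badParam], fun θ₀ => ⟨hnot θ₀, hbetter θ₀⟩⟩, ?_, ?_⟩
  · calc (0.719 : ℝ) < 0.7191 := by norm_num
      _ ≤ RenaultGame.criticalParameter :=
        RenaultGame.le_criticalParameter (by norm_num) (by norm_num)
          fun _ => RenaultGame.sigmaStarOptimal_of_le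
  · calc RenaultGame.criticalParameter
        ≤ RenaultGame.badParam :=
          RenaultGame.criticalParameter_le (p := p) RenaultGame.half_le_badParam
            fun h => hnot 0 (h 0)
      _ < 0.733 := by norm_num [RenaultGame.badParam]
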